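/- Let $\Omega\subset\mathbb R^d$ ($d=1,2,3$) be a bounded domain with smooth boundary, $T>0$, and let $\|\cdot\|$ be the norm of $L^2(\Omega)$. Put $\gamma(\varepsilon)=\varepsilon^{-1/2}$ for $\varepsilon\in(0,1)$. Let $\mathbb W\subset L^2(\Omega)$ be a normed function space, let $C_0,C_1>0$ be constants independent of $\varepsilon$, and let $\mathbf Q_\varepsilon$, $\mathbf P_\varepsilon$ ($\varepsilon\in(0,1)$) be linear mappings on $L^2(\Omega)$ ($\mathbf Q_\varepsilon$ possibly unbounded) with $$\|\mathbf Q_\varepsilon h\|\le C_0\|h\|_{\mathbb W}/\gamma(\varepsilon)\quad (h\in\mathbb W),\qquad \|\mathbf P_\varepsilon h\|\le C_1\log(\gamma(\varepsilon))\,\|h\|\quad (h\in L^2(\Omega)),$$ and $\mathbf P_\varepsilon h=2\Delta h+\mathbf Q_\varepsilon h$ (in the sense of distributions) for $h\in\mathbb W\cap H^1_0(\Omega)$. Assume $3C_1T<2$. Let $u$ be a weak solution of $$u_{tt}+u_t-\Delta u-\Delta u_t=0\ \text{ in }\Omega\times(0,T),\qquad u=0\ \text{ on }\partial\Omega\times(0,T),\qquad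 u(T)=f_0,\ u_t(T)=f_1,$$ with $u\in C([0,T];\mathbb W)$, $u_t\in L^2(0,T;\mathbb W)$ and $\|u\|^2_{C([0,T];\mathbb W)}+\|u_t\|^2_{L^2(0,T;\mathbb W)}\le M$, where $M>0$. Let $0<\varepsilon\le e^{-4/C_1}$, let $f_0^\varepsilon\in H^1(\Omega)$, $f_1^\varepsilon\in L^2(\Omega)$ satisfy $\|f_0^\varepsilon-f_0\|_{H^1(\Omega)}+\|f_1^\varepsilon-f_1\|\le\varepsilon$, and let $u^\varepsilon$ be a weak solution of $$u^\varepsilon_{tt}+u^\varepsilon_t+\Delta u^\varepsilon+\Delta u^\varepsilon_t=\mathbf P_\varepsilon u^\varepsilon+\mathbf P_\varepsilon u^\varepsilon_t\ \text{ in }\Omega\times(0,T),\qquad u^\varepsilon=0\ \text{ on }\partial\Omega\times(0,T),\qquad u^\varepsilon(T)=f^\varepsilon_0,\ u^\varepsilon_t(T)=f^\varepsilon_1.$$ (A weak solution is a function in $L^2(0,T;H^1_0(\Omega))$ with first time derivative in $L^2(0,T;H^1(\Omega))$ and second time derivative in $L^2(0,T;H^{-1}(\Omega))$ that satisfies the equation,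 for a.e. $t$, when tested with any $\varphi\in H^1_0(\Omega)$, and takes the terminal data.) Then for all $t\in[0,T]$, including $t=0$, $$\|u^\varepsilon(t)-u(t)\|^2\le C\Big(\varepsilon+\big(\log(\varepsilon^{-1/2})\big)^{-1}\varepsilon^{1-3C_1(T-t)/2}\Big),$$ $$\|\nabla u^\varepsilon(t)-\nabla u(t)\|^2\le C\Big(\log(\varepsilon^{-1/2})\,\varepsilon+\varepsilon^{1-3C_1(T-t)/2}\Big),$$ $$\|u^\varepsilon_t(t)-u_t(t)\|^2+\int_t^T\|\nabla u^\varepsilon_t(s)-\nabla u_t(s)\|^2\,ds\le C\Big(\big(\log(\varepsilon^{-1/2})\big)^2\varepsilon+\log(\varepsilon^{-1/2})\,\varepsilon^{1-3C_1(T-t)/2}\Big),$$ where $C>0$ depends only on $M$, $C_0$ and $C_1$, and in particular not on $\varepsilon$ and $t$. -/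

import Mathlib

open MeasureTheory Set
open scoped ContDiff

noncomputable section

namespace QuasiRev

/-- The Euclidean space `ℝᵈ`. -/
abbrev E (d : ℕ) : Type := EuclideanSpace ℝ (Fin d)

/-- The real Hilbert space `L²(Ω)`. -/
abbrev L2 {d : ℕ} (Ω : Set (E d)) : Type := Lp ℝ 2 (volume.restrict Ω)

/-- The real Hilbert space `L²(Ω; ℝᵈ)` of square integrable vector fields. -/
abbrev L2Vec {d : ℕ} (Ω : Set (E d)) : Type := Lp (E d) 2 (volume.restrict Ω)

/-- `ψ` is a test function on `Ω`, i.e. `ψ ∈ C_c^∞(Ω)`. -/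
structure IsTest {X : Type*} [NormedAddCommGroup X] [NormedSpace ℝ X] (Ω : Set X) (ψ : X → ℝ) :
    Prop where
  smooth : ContDiff ℝ ∞ ψ
  compact : HasCompactSupport ψ
  support : tsupport ψ ⊆ Ω

lemma integrable_Lp_mul {d : ℕ} {Ω : Set (E d)} {F : Type*} [NormedAddCommGroup F]
    (f : Lp F 2 (volume.restrict Ω)) (L : F → ℝ → ℝ)
    (hL : ∀ {g : E d → F} {h : E d → ℝ}, MemLp g 2 (volume.restrict Ω) →
      MemLp h 2 (volume.restrict Ω) → Integrable (fun x => L (g x) (h x)) (volume.restrict Ω))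
    {h : E d → ℝ} (hc : Continuous h) (hs : HasCompactSupport h) :
    Integrable (fun x => L (f x) (h x)) (volume.restrict Ω) :=
  hL (Lp.memLp f) (hc.memLp_of_hasCompactSupport hs)

lemma integrable_mul_test {d : ℕ} {Ω : Set (E d)} (f : L2 Ω) {ψ : E d → ℝ}
    (hψ : IsTest Ω ψ) (v : E d) :
    Integrable (fun x => f x * fderiv ℝ ψ x v) (volume.restrict Ω) := by
  refine integrable_Lp_mul f (fun a b => a * b) (fun hg hh => hg.integrable_mul hh) ?_ ?_
  · exact (hψ.smooth.continuous_fderiv (by simp)).clm_apply continuous_const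
  · exact hψ.compact.fderiv_apply ℝ v

lemma integrable_inner_test {d : ℕ} {Ω : Set (E d)} (g : L2Vec Ω) {ψ : E d → ℝ}
    (hψ : IsTest Ω ψ) (v : E d) :
    Integrable (fun x => inner ℝ (g x) v * ψ x) (volume.restrict Ω) := by
  refine integrable_Lp_mul g (fun a b => inner ℝ a v * b) (fun hg hh => ?_)
    hψ.smooth.continuous hψ.compact
  exact (hg.inner_const v).integrable_mul hh

/-- The Sobolev space `H¹(Ω)`: the pairs `(f, g)` with `f ∈ L²(Ω)` and `g ∈ L²(Ω; ℝᵈ)` the weak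
gradient of `f`, with the norm `‖(f, g)‖² = ‖f‖² + ‖g‖²`. -/
def H1 {d : ℕ} (Ω : Set (E d)) : Submodule ℝ (WithLp 2 (L2 Ω × L2Vec Ω)) where
  carrier := {p | ∀ ψ : E d → ℝ, IsTest Ω ψ → ∀ v : E d,
    ∫ x in Ω, p.fst x * fderiv ℝ ψ x v = -∫ x in Ω, inner ℝ (p.snd x) v * ψ x}
  zero_mem' := by
    intro ψ _ v
    have h1 : ∫ x in Ω, (0 : L2 Ω) x * fderiv ℝ ψ x v = 0 := by
      apply integral_eq_zero_of_ae
      filter_upwards [Lp.coeFn_zero ℝ 2 (volume.restrict Ω)] with x hx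
      rw [hx]
      simp
    have h2 : ∫ x in Ω, inner ℝ ((0 : L2Vec Ω) x) v * ψ x = 0 := by
      apply integral_eq_zero_of_ae
      filter_upwards [Lp.coeFn_zero (E d) 2 (volume.restrict Ω)] with x hx
      rw [hx]
      simp
    simp only [WithLp.zero_fst, WithLp.zero_snd]
    rw [h1, h2, neg_zero]
  add_mem' := by
    intro p q hp hq ψ hψ v
    have h1 : ∫ x in Ω, (p + q).fst x * fderiv ℝ ψ x v
        = (∫ x in Ω, p.fst x * fderiv ℝ ψ x v) + ∫ x in Ω, q.fst x * fderiv ℝ ψ x v := by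
      rw [← integral_add (integrable_mul_test _ hψ v) (integrable_mul_test _ hψ v)]
      apply integral_congr_ae
      filter_upwards [Lp.coeFn_add p.fst q.fst] with x hx
      simp only [WithLp.add_fst, hx, Pi.add_apply]
      ring
    have h2 : ∫ x in Ω, inner ℝ ((p + q).snd x) v * ψ x
        = (∫ x in Ω, inner ℝ (p.snd x) v * ψ x) + ∫ x in Ω, inner ℝ (q.snd x) v * ψ x := by
      rw [← integral_add (integrable_inner_test _ hψ v) (integrable_inner_test _ hψ v)]
      apply integral_congr_ae
      filter_upwards [Lp.coeFn_add p.snd q.snd] with x hx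
      simp only [WithLp.add_snd, hx, Pi.add_apply, inner_add_left]
      ring
    rw [h1, h2, hp ψ hψ v, hq ψ hψ v]
    ring
  smul_mem' := by
    intro c p hp ψ hψ v
    have h1 : ∫ x in Ω, (c • p).fst x * fderiv ℝ ψ x v
        = c * ∫ x in Ω, p.fst x * fderiv ℝ ψ x v := by
      rw [← integral_const_mul]
      apply integral_congr_ae
      filter_upwards [Lp.coeFn_smul c p.fst] with x hx
      simp only [WithLp.smul_fst, hx, Pi.smul_apply, smul_eq_mul]
      ring
    have h2 : ∫ x in Ω, inner ℝ ((c • p).snd x) v * ψ x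
        = c * ∫ x in Ω, inner ℝ (p.snd x) v * ψ x := by
      rw [← integral_const_mul]
      apply integral_congr_ae
      filter_upwards [Lp.coeFn_smul c p.snd] with x hx
      simp only [WithLp.smul_snd, hx, Pi.smul_apply, real_inner_smul_left]
      ring
    rw [h1, h2, hp ψ hψ v]
    ring

/-- The inclusion `H¹(Ω) → L²(Ω)`. -/
def toL2 {d : ℕ} {Ω : Set (E d)} : H1 Ω →L[ℝ] L2 Ω :=
  (WithLp.fstL 2 ℝ (L2 Ω) (L2Vec Ω)).comp (H1 Ω).subtypeL

/-- The weak gradient `∇ : H¹(Ω) → L²(Ω; ℝᵈ)`. -/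
def grad {d : ℕ} {Ω : Set (E d)} : H1 Ω →L[ℝ] L2Vec Ω :=
  (WithLp.sndL 2 ℝ (L2 Ω) (L2Vec Ω)).comp (H1 Ω).subtypeL

/-- `H¹₀(Ω)`, the closure of `C_c^∞(Ω)` in `H¹(Ω)`. (The set whose span is taken is already a
linear subspace.) -/
def H10 {d : ℕ} (Ω : Set (E d)) : Submodule ℝ (H1 Ω) :=
  (Submodule.span ℝ {p : H1 Ω | ∃ ψ : E d → ℝ, IsTest Ω ψ ∧
    toL2 p =ᵐ[volume.restrict Ω] ψ ∧
    grad p =ᵐ[volume.restrict Ω] gradient ψ}).topologicalClosure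

/-- `H⁻¹(Ω)`, the dual of `H¹₀(Ω)`. -/
abbrev Hm1 {d : ℕ} (Ω : Set (E d)) : Type := StrongDual ℝ (H10 Ω)

/-- The embedding `L²(Ω) → H⁻¹(Ω)`, `h ↦ (φ ↦ ⟨h, φ⟩)`. -/
def toHm1 {d : ℕ} {Ω : Set (E d)} (h : L2 Ω) : Hm1 Ω :=
  (innerSL ℝ h).comp (toL2.comp (H10 Ω).subtypeL)

/-- Lebesgue measure on `(0, T)`. -/
abbrev timeMeasure (T : ℝ) : Measure ℝ := volume.restrict (Ioo 0 T)

/-- `g` is the weak (distributional) derivative of the Banach-space valued function `f`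
on `(0, T)`. -/
def HasWeakTimeDeriv {X : Type*} [NormedAddCommGroup X] [NormedSpace ℝ X] [CompleteSpace X]
    (T : ℝ) (f g : ℝ → X) : Prop :=
  ∀ ψ : ℝ → ℝ, IsTest (Ioo 0 T) ψ →
    ∫ t in Ioo 0 T, deriv ψ t • f t = -∫ t in Ioo 0 T, ψ t • g t

/-- A function `u ∈ L²(0,T; H¹₀(Ω))` with `u_t ∈ L²(0,T; H¹(Ω))` and `u_tt ∈ L²(0,T; H⁻¹(Ω))`.
Such a function has representatives `u ∈ C([0,T]; H¹(Ω))` and `u_t ∈ C([0,T]; L²(Ω))`; these are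
the functions `pos` and `vel`, so that `u(t)`, `∇u(t)`, `u_t(t)` have a meaning for every
`t ∈ [0,T]`. The function `velH1` is `u_t` as an element of `L²(0,T; H¹(Ω))`; `acc` is `u_tt`. -/
structure Evolution {d : ℕ} (Ω : Set (E d)) (T : ℝ) where
  /-- `u` -/
  pos : ℝ → H1 Ω
  /-- `u_t`, as an `L²(Ω)`-valued function -/
  vel : ℝ → L2 Ω
  /-- `u_t`, as an `H¹(Ω)`-valued function -/
  velH1 : ℝ → H1 Ω
  /-- `u_tt` -/
  acc : ℝ → Hm1 Ω
  continuousOn_pos : ContinuousOn pos (Icc 0 T)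
  continuousOn_vel : ContinuousOn vel (Icc 0 T)
  pos_mem : ∀ᵐ t ∂timeMeasure T, pos t ∈ H10 Ω
  memLp_velH1 : MemLp velH1 2 (timeMeasure T)
  memLp_acc : MemLp acc 2 (timeMeasure T)
  velH1_eq : ∀ᵐ t ∂timeMeasure T, toL2 (velH1 t) = vel t
  deriv_pos : HasWeakTimeDeriv T (fun t => toL2 (pos t)) vel
  deriv_vel : HasWeakTimeDeriv T (fun t => toHm1 (vel t)) acc

/-- `u` is a weak solution of `u_tt + u_t - Δu - Δu_t = 0` in `Ω × (0,T)`, `u = 0` on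
`∂Ω × (0,T)`, `u(T) = f₀`, `u_t(T) = f₁`. -/
structure IsOriginalSolution {d : ℕ} {Ω : Set (E d)} {T : ℝ} (f₀ : H1 Ω) (f₁ : L2 Ω)
    (u : Evolution Ω T) : Prop where
  equation : ∀ φ : H10 Ω, ∀ᵐ t ∂timeMeasure T,
    u.acc t φ + inner ℝ (u.vel t) (toL2 (φ : H1 Ω))
      + inner ℝ (grad (u.pos t)) (grad (φ : H1 Ω))
      + inner ℝ (grad (u.velH1 t)) (grad (φ : H1 Ω)) = 0
  terminal_pos : u.pos T = f₀
  terminal_vel : u.vel T = f₁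

/-- `u` is a weak solution of `u_tt + u_t + Δu + Δu_t = P u + P u_t` in `Ω × (0,T)`, `u = 0` on
`∂Ω × (0,T)`, `u(T) = f₀`, `u_t(T) = f₁`. -/
structure IsRegularizedSolution {d : ℕ} {Ω : Set (E d)} {T : ℝ} (P : L2 Ω →ₗ[ℝ] L2 Ω)
    (f₀ : H1 Ω) (f₁ : L2 Ω) (u : Evolution Ω T) : Prop where
  equation : ∀ φ : H10 Ω, ∀ᵐ t ∂timeMeasure T,
    u.acc t φ + inner ℝ (u.vel t) (toL2 (φ : H1 Ω))
      - inner ℝ (grad (u.pos t)) (grad (φ : H1 Ω))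
      - inner ℝ (grad (u.velH1 t)) (grad (φ : H1 Ω))
      = inner ℝ (P (toL2 (u.pos t))) (toL2 (φ : H1 Ω))
        + inner ℝ (P (u.vel t)) (toL2 (φ : H1 Ω))
  terminal_pos : u.pos T = f₀
  terminal_vel : u.vel T = f₁

/-- The linear maps `Q ε` form a family of perturbing operators, with respect to the function
space `W ⊆ L²(Ω)` (the inclusion is `ι`), the auxiliary function `γ` and the constant `C₀`.
The maps `Q ε` need not be continuous on `L²(Ω)`. -/
def IsPerturbingFamily {d : ℕ} {Ω : Set (E d)} {W : Type*} [NormedAddCommGroup W]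
    [NormedSpace ℝ W] (ι : W →ₗ[ℝ] L2 Ω) (γ : ℝ → ℝ) (C₀ : ℝ) (Q : ℝ → L2 Ω →ₗ[ℝ] L2 Ω) : Prop :=
  ∀ ε ∈ Ioo (0 : ℝ) 1, ∀ w : W, ‖Q ε (ι w)‖ ≤ C₀ * ‖w‖ / γ ε

/-- The linear maps `P ε` form a family of stabilized operators, with respect to the auxiliary
function `γ` and the constant `C₁`. -/
def IsStabilizedFamily {d : ℕ} {Ω : Set (E d)} (γ : ℝ → ℝ) (C₁ : ℝ)
    (P : ℝ → L2 Ω →ₗ[ℝ] L2 Ω) : Prop :=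
  ∀ ε ∈ Ioo (0 : ℝ) 1, ∀ h : L2 Ω, ‖P ε h‖ ≤ C₁ * Real.log (γ ε) * ‖h‖

/-- The relation `P ε h = 2 Δh + Q ε h`, where `Δ` is the distributional Laplacian, for the
functions `h ∈ H¹₀(Ω)` that lie in `W`. -/
def StabilizesLaplacian {d : ℕ} {Ω : Set (E d)} {W : Type*} [NormedAddCommGroup W]
    [NormedSpace ℝ W] (ι : W →ₗ[ℝ] L2 Ω) (Q P : ℝ → L2 Ω →ₗ[ℝ] L2 Ω) : Prop :=
  ∀ ε ∈ Ioo (0 : ℝ) 1, ∀ h ∈ H10 Ω, toL2 h ∈ LinearMap.range ι → ∀ φ ∈ H10 Ω,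
    inner ℝ (P ε (toL2 h)) (toL2 φ)
      = -2 * inner ℝ (grad h) (grad φ) + inner ℝ (Q ε (toL2 h)) (toL2 φ)

end QuasiRev

end

open QuasiRev

section

open Filter Topology

/-! Since `P u = 2Δu + Q u`, the exact solution solves the regularized equation up to the small
source `-(Q u + Q u_t)`. For the difference `w = uε - u`, the combination `y = w + w_t` turns the
second order equation into the first order one `y' = -Δy + P y + G` with `G = Q u + Q u_t`. Solved
from time `T` downwards it is parabolic, and `P` is bounded by `ρ = C₁ℓ`, where `ℓ = log(ε^(-1/2))`.
Testing with `y` gives `(‖y‖²)' ≥ 2‖∇y‖² - 3ρ‖y‖² - ρ⁻¹‖G‖²`, hence `‖y(t)‖² + 2∫_t^T ‖∇y‖² ≤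
exp(3ρ(T-t)) (‖y(T)‖² + ρ⁻¹∫‖G‖²)`. The exponential is `ε^(-3C₁(T-t)/2)`, the terminal term is at
most `ε²`, and `∫‖G‖²` is of order `ε`. As `ε² ≤ ℓ⁻¹ε`, the right side is at most a constant times
`ℓ⁻¹R`, with `R = ε^(1-3C₁(T-t)/2)` (`error_parameters`).

The relation `w' = y - w` and Grönwall's inequality in `H¹` bound `w` (`bounds_of_energy`), and then
`w_t = y - w` is bounded as well (`velocity_bound_of_bounds`). So one quantity `κℓ⁻¹R` dominates all
three errors, and it lies below each claimed right side because `ℓ ≥ 2/C₁`.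

The analytic difficulty is that `y'` lies only in `H⁻¹`, so the test with `y` is not immediate. It
is done with Steklov averages, which are `C¹` in `L²` and stay in `H¹₀` (`steklov_energy_estimate`).
The limit uses Lebesgue differentiation and Fatou's lemma (`energy_estimate`). -/

/-! ### Weak time derivatives and the fundamental theorem of calculus. -/

lemma deriv_smoothTransition_of_notMem {x : ℝ} (hx : x ∉ Icc (0 : ℝ) 1) :
    deriv Real.smoothTransition x = 0 := by
  rw [mem_Icc, not_and_or, not_le, not_le] at hx
  rcases hx with hx | hx
  · have : Real.smoothTransition =ᶠ[𝓝 x] fun _ => 0 := by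
      filter_upwards [Iio_mem_nhds hx] with y hy
      exact Real.smoothTransition.zero_of_nonpos (le_of_lt hy)
    rw [this.deriv_eq, deriv_const]
  · have : Real.smoothTransition =ᶠ[𝓝 x] fun _ => 1 := by
      filter_upwards [Ioi_mem_nhds hx] with y hy
      exact Real.smoothTransition.one_of_one_le (le_of_lt hy)
    rw [this.deriv_eq, deriv_const]

lemma differentiable_smoothTransition : Differentiable ℝ Real.smoothTransition :=
  (Real.smoothTransition.contDiff (n := 1)).differentiable (by simp)

lemma continuous_deriv_smoothTransition : Continuous (deriv Real.smoothTransition) :=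
  (Real.smoothTransition.contDiff (n := 1)).continuous_deriv (by simp)

lemma hasCompactSupport_deriv_smoothTransition :
    HasCompactSupport (deriv Real.smoothTransition) :=
  HasCompactSupport.intro isCompact_Icc fun _ hx => deriv_smoothTransition_of_notMem hx

lemma integral_deriv_smoothTransition : ∫ x, deriv Real.smoothTransition x = 1 := by
  have h := integral_of_hasDerivAt_of_tendsto (f := Real.smoothTransition)
    (f' := deriv Real.smoothTransition) (m := 0) (n := 1)
    (fun x => (differentiable_smoothTransition x).hasDerivAt)
    (continuous_deriv_smoothTransition.integrable_of_hasCompactSupport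
      hasCompactSupport_deriv_smoothTransition)
    (tendsto_const_nhds.congr' (by
      filter_upwards [eventually_le_atBot 0] with y hy
      exact (Real.smoothTransition.zero_of_nonpos hy).symm))
    (tendsto_const_nhds.congr' (by
      filter_upwards [eventually_ge_atTop 1] with y hy
      exact (Real.smoothTransition.one_of_one_le hy).symm))
  simpa using h

/-- The rescaled derivatives of the smooth transition function form an approximate identity. -/
lemma tendsto_setIntegral_deriv_smoothTransition {X : Type*} [NormedAddCommGroup X]
    [NormedSpace ℝ X] [CompleteSpace X] {T a : ℝ} (ha : a ∈ Ioo 0 T) {f : ℝ → X}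
    (hf : ContinuousOn f (Icc 0 T)) :
    Tendsto (fun c : ℝ => ∫ t in Ioo 0 T, (c * deriv Real.smoothTransition (c * (t - a))) • f t)
      atTop (𝓝 (f a)) := by
  have hi : Integrable ((Ioo 0 T).indicator f) :=
    (integrable_indicator_iff measurableSet_Ioo).2
      ((hf.integrableOn_compact isCompact_Icc).mono_set Ioo_subset_Icc_self)
  have hc : ContinuousAt ((Ioo 0 T).indicator f) a := by
    refine (hf.continuousAt (Icc_mem_nhds ha.1 ha.2)).congr ?_
    filter_upwards [Ioo_mem_nhds ha.1 ha.2] with x hx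
    rw [indicator_of_mem hx]
  have h0 : Tendsto (fun x : ℝ => ‖x‖ ^ Module.finrank ℝ ℝ * deriv Real.smoothTransition x)
      (Bornology.cobounded ℝ) (𝓝 0) := by
    refine tendsto_const_nhds.congr' ?_
    have : (Icc (0 : ℝ) 1)ᶜ ∈ Bornology.cobounded ℝ :=
      Bornology.isBounded_def.1 (Metric.isBounded_Icc 0 1)
    filter_upwards [this] with x hx
    rw [deriv_smoothTransition_of_notMem hx, mul_zero]
  have key := tendsto_integral_comp_smul_smul_of_integrable (μ := (volume : Measure ℝ))
    (φ := deriv Real.smoothTransition)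
    (fun x => Real.smoothTransition.monotone.deriv_nonneg) integral_deriv_smoothTransition h0
    (g := fun x => (Ioo 0 T).indicator f (x + a)) (hi.comp_add_right a)
    (ContinuousAt.comp (f := fun x : ℝ => x + a) (g := (Ioo 0 T).indicator f) (x := 0)
      (by simpa using hc) (by fun_prop))
  simp only [zero_add, indicator_of_mem ha] at key
  refine key.congr fun c => ?_
  rw [← integral_indicator measurableSet_Ioo]
  refine Eq.trans ?_ (integral_add_right_eq_self _ a)
  refine integral_congr_ae (Eventually.of_forall fun x => ?_)
  by_cases hx : x + a ∈ Ioo 0 T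
  · simp [hx]
  · simp [hx]

/-- A continuous function with integrable weak derivative is the integral of that derivative. -/
lemma QuasiRev.HasWeakTimeDeriv.integral_eq_sub {X : Type*} [NormedAddCommGroup X]
    [NormedSpace ℝ X] [CompleteSpace X] {T : ℝ} {f g : ℝ → X} (h : HasWeakTimeDeriv T f g)
    (hf : ContinuousOn f (Icc 0 T)) (hg : IntegrableOn g (Ioo 0 T)) {a b : ℝ}
    (ha : 0 ≤ a) (hab : a ≤ b) (hb : b ≤ T) :
    ∫ t in a..b, g t = f b - f a := by
  rcases hab.eq_or_lt with rfl | hab'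
  · simp
  have hT : 0 < T := ha.trans_lt (hab'.trans_le hb)
  have interior : ∀ a ∈ Ioo 0 T, ∀ b ∈ Ioo 0 T, a < b → ∫ t in a..b, g t = f b - f a := by
    intro a ha b hb hab
    -- A smooth approximation of the indicator of `(a, b]`: it rises on `[a, a + 1/c]` and falls on
    -- `[b, b + 1/c]`. Its derivative is a difference of two approximate identities, so pairing it
    -- with `f` gives `f a - f b` in the limit.
    set ψ : ℝ → ℝ → ℝ := fun c t =>
      Real.smoothTransition (c * (t - a)) - Real.smoothTransition (c * (t - b)) with hψ
    have hsm : ∀ c, ContDiff ℝ ∞ (ψ c) := by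
      intro c
      have := Real.smoothTransition.contDiff (n := ⊤)
      exact (this.comp (by fun_prop)).sub (this.comp (by fun_prop))
    have hsupp : ∀ c > 0, ∀ t ∉ Icc a (b + 1 / c), ψ c t = 0 := by
      intro c hc t ht
      rw [mem_Icc, not_and_or, not_le, not_le] at ht
      rcases ht with ht | ht
      · have h1 : c * (t - a) ≤ 0 := mul_nonpos_of_nonneg_of_nonpos hc.le (by linarith)
        have h2 : c * (t - b) ≤ 0 := mul_nonpos_of_nonneg_of_nonpos hc.le (by linarith)
        simp only [hψ, Real.smoothTransition.zero_of_nonpos h1,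
          Real.smoothTransition.zero_of_nonpos h2, sub_zero]
      · have h2 : 1 ≤ c * (t - b) := by
          have : c * (1 / c) = 1 := by field_simp
          rw [← this]
          exact mul_le_mul_of_nonneg_left (by linarith) hc.le
        have h1 : 1 ≤ c * (t - a) := h2.trans (mul_le_mul_of_nonneg_left (by linarith) hc.le)
        simp only [hψ, Real.smoothTransition.one_of_one_le h1,
          Real.smoothTransition.one_of_one_le h2, sub_self]
    have hderiv : ∀ c t, deriv (ψ c) t = c * deriv Real.smoothTransition (c * (t - a))
        - c * deriv Real.smoothTransition (c * (t - b)) := by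
      intro c t
      have aux : ∀ e : ℝ, HasDerivAt (fun t => Real.smoothTransition (c * (t - e)))
          (c * deriv Real.smoothTransition (c * (t - e))) t := by
        intro e
        have h1 := (differentiable_smoothTransition (c * (t - e))).hasDerivAt
        have h2 : HasDerivAt (fun t : ℝ => c * (t - e)) c t := by
          simpa using ((hasDerivAt_id t).sub_const e).const_mul c
        have := h1.comp t h2
        rwa [mul_comm] at this
      exact ((aux a).sub (aux b)).deriv
    have htest : ∀ᶠ c : ℝ in atTop, IsTest (Ioo 0 T) (ψ c) := by
      -- The condition `1/c < T - b` keeps the support `[a, b + 1/c]` inside the open interval.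
      filter_upwards [eventually_gt_atTop (1 / (T - b)), eventually_gt_atTop 0] with c hc hc0
      have hlt : b + 1 / c < T := by
        have : 1 / c < T - b := by
          rw [div_lt_comm₀ hc0 (by linarith [hb.2])]
          exact hc
        linarith
      refine ⟨hsm c, HasCompactSupport.intro isCompact_Icc (hsupp c hc0), ?_⟩
      have : tsupport (ψ c) ⊆ Icc a (b + 1 / c) :=
        closure_minimal (fun x hx => by_contra fun hn => hx (hsupp c hc0 x hn)) isClosed_Icc
      exact this.trans fun x hx => ⟨ha.1.trans_le hx.1, hx.2.trans_lt hlt⟩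
    have hL : Tendsto (fun c => ∫ t in Ioo 0 T, deriv (ψ c) t • f t) atTop (𝓝 (f a - f b)) := by
      have := (tendsto_setIntegral_deriv_smoothTransition ha hf).sub
        (tendsto_setIntegral_deriv_smoothTransition hb hf)
      refine this.congr fun c => ?_
      have hint : ∀ e : ℝ, IntegrableOn
          (fun t => (c * deriv Real.smoothTransition (c * (t - e))) • f t) (Ioo 0 T) := by
        intro e
        have hcont : Continuous fun t => c * deriv Real.smoothTransition (c * (t - e)) :=
          continuous_const.mul (continuous_deriv_smoothTransition.comp (by fun_prop))
        exact ((hcont.continuousOn.smul hf).integrableOn_compact isCompact_Icc).mono_set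
          Ioo_subset_Icc_self
      rw [← integral_sub (hint a) (hint b)]
      refine integral_congr_ae (Eventually.of_forall fun t => ?_)
      simp only [hderiv, sub_smul]
    have hR : Tendsto (fun c => ∫ t in Ioo 0 T, ψ c t • g t) atTop
        (𝓝 (∫ t in Ioo 0 T, (Ioc a b).indicator g t)) := by
      refine tendsto_integral_filter_of_dominated_convergence (fun t => ‖g t‖) ?_ ?_ hg.norm ?_
      · exact Eventually.of_forall fun c =>
          (hsm c).continuous.aestronglyMeasurable.smul hg.aestronglyMeasurable
      · refine Eventually.of_forall fun c => Eventually.of_forall fun t => ?_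
        rw [norm_smul]
        have : ‖ψ c t‖ ≤ 1 := by
          rw [Real.norm_eq_abs, abs_le]
          constructor <;> simp only [hψ] <;>
            linarith [Real.smoothTransition.nonneg (c * (t - a)),
              Real.smoothTransition.nonneg (c * (t - b)),
              Real.smoothTransition.le_one (c * (t - a)),
              Real.smoothTransition.le_one (c * (t - b))]
        exact mul_le_of_le_one_left (norm_nonneg _) this
      -- At `t = e` the limit is `0`, which is why the limit of `ψ c` is exactly the indicator of
      -- the half-open `Ioc a b`.
      · have lim : ∀ e t : ℝ, Tendsto (fun c : ℝ => Real.smoothTransition (c * (t - e))) atTop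
            (𝓝 (if e < t then 1 else 0)) := by
          intro e t
          split_ifs with het
          · refine tendsto_const_nhds.congr' ?_
            filter_upwards [eventually_ge_atTop (1 / (t - e))] with c hc
            refine (Real.smoothTransition.one_of_one_le ?_).symm
            rwa [div_le_iff₀ (by linarith)] at hc
          · refine tendsto_const_nhds.congr' ?_
            filter_upwards [eventually_ge_atTop 0] with c hc
            exact (Real.smoothTransition.zero_of_nonpos
              (mul_nonpos_of_nonneg_of_nonpos hc (by linarith))).symm
        refine Eventually.of_forall fun t => ?_
        have := ((lim a t).sub (lim b t)).smul_const (g t)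
        convert this using 2
        simp only [indicator, mem_Ioc]
        by_cases h1 : a < t <;> by_cases h2 : b < t
        · simp [h1, h2, not_le.2 h2]
        · simp [h1, h2, not_lt.1 h2]
        · exact absurd (hab.trans h2) h1
        · simp [h1, h2]
    have heq := tendsto_nhds_unique (hL.congr' (by
      filter_upwards [htest] with c hc
      exact h _ hc)) hR.neg
    have hsub : Ioc a b ⊆ Ioo 0 T := fun x hx => ⟨ha.1.trans hx.1, hx.2.trans_lt hb.2⟩
    rw [setIntegral_indicator measurableSet_Ioc, inter_eq_right.2 hsub,
      ← intervalIntegral.integral_of_le hab.le] at heq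
    rw [← neg_eq_iff_eq_neg, neg_sub] at heq
    exact heq.symm
  have hgi : IntegrableOn g (Icc 0 T) := (integrableOn_Icc_iff_integrableOn_Ioo).2 hg
  have hprim : ContinuousOn (fun x => ∫ t in (0 : ℝ)..x, g t) (Icc 0 T) := by
    rw [← uIcc_of_le hT.le] at hgi ⊢
    exact intervalIntegral.continuousOn_primitive_interval hgi
  -- The endpoints `0` and `T` are reached by continuity: `f` minus the primitive of `g` is constant
  -- on the open interval and continuous on the closed one.
  have hconst : ∃ k, EqOn (fun x => f x - ∫ t in (0 : ℝ)..x, g t) (fun _ => k) (Ioo 0 T) := by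
    refine ⟨f (T / 2) - ∫ t in (0 : ℝ)..(T / 2), g t, ?_⟩
    have hmid : T / 2 ∈ Ioo 0 T := ⟨by linarith, by linarith⟩
    have hii : ∀ x ∈ Ioo 0 T, IntervalIntegrable g volume 0 x := fun x hx =>
      (intervalIntegrable_iff_integrableOn_Ioc_of_le hx.1.le).2
        (hgi.mono_set fun y hy => ⟨hy.1.le, hy.2.trans hx.2.le⟩)
    have aux : ∀ x ∈ Ioo 0 T, ∀ y ∈ Ioo 0 T, x < y →
        f x - ∫ t in (0 : ℝ)..x, g t = f y - ∫ t in (0 : ℝ)..y, g t := by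
      intro x hx y hy hxy
      have := interior x hx y hy hxy
      rw [← intervalIntegral.integral_interval_sub_left (hii y hy) (hii x hx)] at this
      rw [sub_eq_sub_iff_add_eq_add] at this ⊢
      rw [add_comm (f x), add_comm (f y), this, add_comm, add_comm _ (f y)]
    intro x hx
    rcases lt_trichotomy x (T / 2) with h1 | h1 | h1
    · exact aux x hx _ hmid h1
    · rw [h1]
    · exact (aux _ hmid x hx h1).symm
  obtain ⟨k, hk⟩ := hconst
  have hall : EqOn (fun x => f x - ∫ t in (0 : ℝ)..x, g t) (fun _ => k) (Icc 0 T) := by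
    rw [← closure_Ioo hT.ne]
    exact hk.of_subset_closure (by rw [closure_Ioo hT.ne]; exact hf.sub hprim)
      continuousOn_const subset_closure subset_rfl
  have e1 := hall ⟨ha, hab.trans hb⟩
  have e2 := hall ⟨ha.trans hab, hb⟩
  have hii : ∀ x ∈ Icc 0 T, IntervalIntegrable g volume 0 x := fun x hx =>
    (intervalIntegrable_iff_integrableOn_Ioc_of_le hx.1).2
      (hgi.mono_set fun y hy => ⟨hy.1.le, hy.2.trans hx.2⟩)
  rw [← intervalIntegral.integral_interval_sub_left (hii b ⟨ha.trans hab, hb⟩)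
    (hii a ⟨ha, hab.trans hb⟩)]
  simp only at e1 e2
  rw [sub_eq_iff_eq_add] at e1 e2
  rw [e1, e2]
  abel

/-! ### Completeness of `H¹(Ω)` and uniqueness of weak gradients. -/

/-- For fixed `ψ` and `v`, both sides of the defining identity are inner products with fixed `L²`
elements, namely `∂_v ψ` and `ψ v`, so each constraint is closed. The resulting completeness is what
Bochner integrals with values in `H¹(Ω)` require. -/
lemma isClosed_H1 {d : ℕ} (Ω : Set (E d)) :
    IsClosed (H1 Ω : Set (WithLp 2 (L2 Ω × L2Vec Ω))) := by
  have hset : (H1 Ω : Set (WithLp 2 (L2 Ω × L2Vec Ω))) =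
      ⋂ (ψ : E d → ℝ) (_ : IsTest Ω ψ) (v : E d), {p |
        ∫ x in Ω, p.fst x * fderiv ℝ ψ x v = -∫ x in Ω, inner ℝ (p.snd x) v * ψ x} := by
    ext p
    simp only [mem_iInter]
    rfl
  rw [hset]
  refine isClosed_iInter fun ψ => isClosed_iInter fun hψ => isClosed_iInter fun v => ?_
  have m1 : MemLp (fun x => fderiv ℝ ψ x v) 2 (volume.restrict Ω) :=
    Continuous.memLp_of_hasCompactSupport
      ((hψ.smooth.continuous_fderiv (by simp)).clm_apply continuous_const)
      (hψ.compact.fderiv_apply ℝ v)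
  have m2 : MemLp (fun x => ψ x • v) 2 (volume.restrict Ω) :=
    Continuous.memLp_of_hasCompactSupport (hψ.smooth.continuous.smul continuous_const)
      hψ.compact.smul_right
  have e1 : ∀ p : WithLp 2 (L2 Ω × L2Vec Ω),
      ∫ x in Ω, p.fst x * fderiv ℝ ψ x v = inner ℝ p.fst (m1.toLp _) := by
    intro p
    rw [L2.inner_def]
    refine integral_congr_ae ?_
    filter_upwards [m1.coeFn_toLp] with x hx
    rw [hx]
    simp [mul_comm]
  have e2 : ∀ p : WithLp 2 (L2 Ω × L2Vec Ω),
      ∫ x in Ω, inner ℝ (p.snd x) v * ψ x = inner ℝ p.snd (m2.toLp _) := by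
    intro p
    rw [L2.inner_def]
    refine integral_congr_ae ?_
    filter_upwards [m2.coeFn_toLp] with x hx
    rw [hx, inner_smul_right, mul_comm]
  simp only [e1, e2]
  exact isClosed_eq
    ((WithLp.fstL 2 ℝ (L2 Ω) (L2Vec Ω)).continuous.inner continuous_const)
    ((WithLp.sndL 2 ℝ (L2 Ω) (L2Vec Ω)).continuous.inner continuous_const).neg

instance {d : ℕ} (Ω : Set (E d)) : CompleteSpace (H1 Ω) :=
  (isClosed_H1 Ω).completeSpace_coe

lemma isClosed_H10 {d : ℕ} (Ω : Set (E d)) : IsClosed (H10 Ω : Set (H1 Ω)) :=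
  Submodule.isClosed_topologicalClosure _

/-- Weak gradients on an open set are unique. -/
lemma toL2_injective {d : ℕ} {Ω : Set (E d)} (hΩ : IsOpen Ω) :
    Function.Injective (toL2 : H1 Ω → L2 Ω) := by
  refine (injective_iff_map_eq_zero toL2).2 fun p hp => ?_
  have hfst : (p : WithLp 2 (L2 Ω × L2Vec Ω)).fst = 0 := hp
  have hsnd : (p : WithLp 2 (L2 Ω × L2Vec Ω)).snd = 0 := by
    have hall : ∀ v : E d, ∀ᵐ x ∂(volume.restrict Ω),
        inner ℝ ((p : WithLp 2 (L2 Ω × L2Vec Ω)).snd x) v = 0 := by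
      intro v
      rw [ae_restrict_iff' hΩ.measurableSet]
      -- When the `L²` part vanishes, integration by parts says that each component of the gradient
      -- annihilates all test functions.
      refine hΩ.ae_eq_zero_of_integral_contDiff_smul_eq_zero ?_ fun ψ h1 h2 h3 => ?_
      · have : MemLp (fun x => inner ℝ ((p : WithLp 2 (L2 Ω × L2Vec Ω)).snd x) v) 2
            (volume.restrict Ω) := (Lp.memLp _).inner_const v
        exact locallyIntegrableOn_of_locallyIntegrable_restrict
          (this.locallyIntegrable (by norm_num))
      · have h := p.2 ψ ⟨h1, h2, h3⟩ v
        have h0 : ∫ x in Ω, (p : WithLp 2 (L2 Ω × L2Vec Ω)).fst x * fderiv ℝ ψ x v = 0 := by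
          rw [hfst]
          refine integral_eq_zero_of_ae ?_
          filter_upwards [Lp.coeFn_zero ℝ 2 (volume.restrict Ω)] with x hx
          rw [hx]
          simp
        rw [h0, zero_eq_neg] at h
        rw [← setIntegral_eq_integral_of_forall_compl_eq_zero (s := Ω), ← h]
        · exact integral_congr_ae (Eventually.of_forall fun x => by simp [mul_comm])
        · intro x hx
          rw [image_eq_zero_of_notMem_tsupport fun hx' => hx (h3 hx'), zero_smul]
    refine (Lp.eq_zero_iff_ae_eq_zero).2 ?_
    have hb : ∀ᵐ x ∂(volume.restrict Ω), ∀ i : Fin d,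
        inner ℝ ((p : WithLp 2 (L2 Ω × L2Vec Ω)).snd x) (EuclideanSpace.single i (1 : ℝ)) = 0 :=
      ae_all_iff.2 fun i => hall _
    filter_upwards [hb] with x hx
    ext i
    simpa [EuclideanSpace.inner_single_right] using hx i
  refine Subtype.ext ?_
  refine (WithLp.ofLp_injective 2) (Prod.ext hfst hsnd)

lemma norm_sq_eq_toL2_add_grad {d : ℕ} {Ω : Set (E d)} (p : H1 Ω) :
    ‖p‖ ^ 2 = ‖toL2 p‖ ^ 2 + ‖grad p‖ ^ 2 :=
  WithLp.prod_norm_sq_eq_of_L2 (p : WithLp 2 (L2 Ω × L2Vec Ω))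

lemma norm_toL2_le {d : ℕ} {Ω : Set (E d)} (p : H1 Ω) : ‖toL2 p‖ ≤ ‖p‖ :=
  le_of_sq_le_sq (by rw [norm_sq_eq_toL2_add_grad]; nlinarith [sq_nonneg ‖grad p‖]) (norm_nonneg _)

lemma norm_grad_le {d : ℕ} {Ω : Set (E d)} (p : H1 Ω) : ‖grad p‖ ≤ ‖p‖ :=
  le_of_sq_le_sq (by rw [norm_sq_eq_toL2_add_grad]; nlinarith [sq_nonneg ‖toL2 p‖]) (norm_nonneg _)

lemma continuous_toHm1 {d : ℕ} {Ω : Set (E d)} : Continuous (toHm1 : L2 Ω → Hm1 Ω) :=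
  (ContinuousLinearMap.precomp ℝ (toL2.comp (H10 Ω).subtypeL)).continuous.comp
    (innerSL ℝ).continuous

/-- Fatou's lemma for real integrals, along a filter with convergent upper bounds. -/
lemma integral_le_of_tendsto_of_integral_le {α ι : Type*} [MeasurableSpace α] {μ : Measure α}
    {l : Filter ι} [l.IsCountablyGenerated] [l.NeBot] {F : ι → α → ℝ} {f : α → ℝ} {b : ι → ℝ} {B : ℝ}
    (hF0 : ∀ i x, 0 ≤ F i x) (hFi : ∀ i, Integrable (F i) μ) (hf0 : ∀ x, 0 ≤ f x)
    (hfi : Integrable f μ) (hlim : ∀ᵐ x ∂μ, Tendsto (fun i => F i x) l (𝓝 (f x)))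
    (hb : ∀ᶠ i in l, ∫ x, F i x ∂μ ≤ b i) (hB : Tendsto b l (𝓝 B)) : ∫ x, f x ∂μ ≤ B := by
  have hB0 : 0 ≤ B := ge_of_tendsto hB (by
    filter_upwards [hb] with i hi
    exact (integral_nonneg (hF0 i)).trans hi)
  rw [integral_eq_lintegral_of_nonneg_ae (Eventually.of_forall hf0) hfi.aestronglyMeasurable]
  refine ENNReal.toReal_le_of_le_ofReal hB0 ?_
  calc ∫⁻ x, ENNReal.ofReal (f x) ∂μ
      = ∫⁻ x, liminf (fun i => ENNReal.ofReal (F i x)) l ∂μ := by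
        refine lintegral_congr_ae ?_
        filter_upwards [hlim] with x hx
        exact (ENNReal.tendsto_ofReal hx).liminf_eq.symm
    _ ≤ liminf (fun i => ∫⁻ x, ENNReal.ofReal (F i x) ∂μ) l :=
        lintegral_liminf_le' fun i => (hFi i).aestronglyMeasurable.aemeasurable.ennreal_ofReal
    _ ≤ liminf (fun i => ENNReal.ofReal (b i)) l := by
        refine liminf_le_liminf ?_
        filter_upwards [hb] with i hi
        rw [← ofReal_integral_eq_lintegral_ofReal (hFi i) (Eventually.of_forall (hF0 i))]
        exact ENNReal.ofReal_le_ofReal hi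
    _ = ENNReal.ofReal B := (ENNReal.tendsto_ofReal hB).liminf_eq

/-! ### Steklov averages in time. -/

section Steklov

variable {V : Type*} [NormedAddCommGroup V] [NormedSpace ℝ V]

/-- The forward Steklov average of a function. -/
noncomputable def steklov (h : ℝ) (f : ℝ → V) (s : ℝ) : V := h⁻¹ • ∫ r in s..(s + h), f r

lemma integral_add_eq_sub {f : ℝ → V} (hf : ∀ a b, IntervalIntegrable f volume a b) (c s h : ℝ) :
    ∫ r in s..(s + h), f r = (∫ r in c..(s + h), f r) - ∫ r in c..s, f r :=
  (intervalIntegral.integral_interval_sub_left (hf _ _) (hf _ _)).symm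

lemma continuous_integral_add {f : ℝ → V} (hf : ∀ a b, IntervalIntegrable f volume a b) (h : ℝ) :
    Continuous fun s => ∫ r in s..(s + h), f r := by
  simp only [integral_add_eq_sub hf 0]
  have := intervalIntegral.continuous_primitive hf 0
  exact (this.comp (by fun_prop)).sub this

lemma continuous_steklov {f : ℝ → V} (hf : ∀ a b, IntervalIntegrable f volume a b) (h : ℝ) :
    Continuous (steklov h f) :=
  continuous_const.smul (continuous_integral_add hf h)

/-- Averaging a merely continuous curve makes it `C¹` in the same space. The derivative is a
difference quotient, which the time-integrated weak equation evaluates directly. -/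
lemma hasDerivAt_steklov [CompleteSpace V] {f : ℝ → V} (hf : Continuous f) (h s : ℝ) :
    HasDerivAt (steklov h f) (h⁻¹ • (f (s + h) - f s)) s := by
  have hi : ∀ a b, IntervalIntegrable f volume a b := fun a b => hf.intervalIntegrable a b
  have h1 : ∀ x, HasDerivAt (fun u => ∫ r in (0 : ℝ)..u, f r) (f x) x := fun x =>
    intervalIntegral.integral_hasDerivAt_right (hi _ _) (hf.stronglyMeasurableAtFilter _ _)
      hf.continuousAt
  have h2 := (((h1 (s + h)).scomp s ((hasDerivAt_id s).add_const h)).sub (h1 s)).const_smul h⁻¹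
  simp only [one_smul] at h2
  refine h2.congr_of_eventuallyEq (Eventually.of_forall fun x => ?_)
  simp [steklov, integral_add_eq_sub hi 0 x h]

/-- A forward average is a difference quotient of the primitive, so convergence at `s` is
differentiability of the primitive there. -/
lemma tendsto_steklov {f : ℝ → V} (hf : ∀ a b, IntervalIntegrable f volume a b) {c s : ℝ}
    (hs : HasDerivAt (fun u => ∫ r in c..u, f r) (f s) s) :
    Tendsto (fun h => steklov h f s) (𝓝[>] 0) (𝓝 (f s)) := by
  have := hasDerivAt_iff_tendsto_slope_zero.1 hs
  refine (this.mono_left (nhdsWithin_mono _ fun x hx => ne_of_gt hx)).congr fun h => ?_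
  rw [steklov, integral_add_eq_sub hf c]

lemma tendsto_steklov_of_continuous [CompleteSpace V] {f : ℝ → V} (hf : Continuous f) (s : ℝ) :
    Tendsto (fun h => steklov h f s) (𝓝[>] 0) (𝓝 (f s)) :=
  tendsto_steklov (c := 0) (fun a b => hf.intervalIntegrable a b)
    (intervalIntegral.integral_hasDerivAt_right (hf.intervalIntegrable _ _)
      (hf.stronglyMeasurableAtFilter _ _) hf.continuousAt)

lemma ae_tendsto_steklov [CompleteSpace V] {f : ℝ → V} (hf : Integrable f) :
    ∀ᵐ s, Tendsto (fun h => steklov h f s) (𝓝[>] 0) (𝓝 (f s)) := by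
  filter_upwards [LocallyIntegrable.ae_hasDerivAt_integral hf.locallyIntegrable] with s hs
  exact tendsto_steklov (fun a b => hf.intervalIntegrable) (hs 0)

/-- Steklov averages stay in a closed subspace. -/
lemma steklov_mem [CompleteSpace V] {f : ℝ → V} (hf : ∀ a b, IntervalIntegrable f volume a b) {S : Submodule ℝ V}
    (hS : IsClosed (S : Set V)) {h s : ℝ} (hh : 0 < h)
    (hmem : ∀ᵐ r ∂(volume.restrict (Ioc s (s + h))), f r ∈ S) : steklov h f s ∈ S := by
  have := S.convex.set_average_mem (μ := volume) (t := Ioc s (s + h)) hS (by simp [hh]) (by simp)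
    hmem ((intervalIntegrable_iff_integrableOn_Ioc_of_le (by linarith)).1 (hf s (s + h)))
  rw [setAverage_eq] at this
  rw [steklov, intervalIntegral.integral_of_le (by linarith)]
  simpa [hh.le] using this

lemma map_steklov [CompleteSpace V] {H : Type*} [NormedAddCommGroup H] [NormedSpace ℝ H] [CompleteSpace H]
    (A : V →L[ℝ] H) {f : ℝ → V} (hf : ∀ a b, IntervalIntegrable f volume a b) (h s : ℝ) :
    A (steklov h f s) = steklov h (fun r => A (f r)) s := by
  rw [steklov, steklov, map_smul, A.intervalIntegral_comp_comm (hf _ _)]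

/-- With `Φ` the primitive of `g` from `t`, the double integral telescopes to `∫_r^(r+h) Φ -
∫_t^(t+h) Φ`. Monotonicity of `Φ` bounds the first term by `h Φ(r+h)`, and the second integral is
nonnegative. This removes the average from the source term `‖G‖²`. -/
lemma integral_integral_add_le {g : ℝ → ℝ} (hg : ∀ a b, IntervalIntegrable g volume a b)
    (hg0 : ∀ x, 0 ≤ g x) {h : ℝ} (hh : 0 ≤ h) (t r : ℝ) :
    ∫ s in t..r, ∫ x in s..(s + h), g x ≤ h * ∫ x in t..(r + h), g x := by
  set Φ : ℝ → ℝ := fun x => ∫ u in t..x, g u with hΦ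
  have hc : Continuous Φ := intervalIntegral.continuous_primitive hg t
  have hi : ∀ a b, IntervalIntegrable Φ volume a b := fun a b => hc.intervalIntegrable a b
  have hmono : Monotone Φ := by
    intro a b hab
    have : Φ b - Φ a = ∫ u in a..b, g u :=
      intervalIntegral.integral_interval_sub_left (hg _ _) (hg _ _)
    linarith [intervalIntegral.integral_nonneg hab (μ := volume) fun u _ => hg0 u]
  have h1 : ∫ s in t..r, ∫ x in s..(s + h), g x
      = (∫ s in (t + h)..(r + h), Φ s) - ∫ s in t..r, Φ s := by
    simp only [integral_add_eq_sub hg t]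
    have hc' : Continuous fun s => Φ (s + h) := hc.comp (by fun_prop)
    refine (intervalIntegral.integral_sub (hc'.intervalIntegrable t r) (hi t r)).trans ?_
    congr 1
    exact intervalIntegral.integral_comp_add_right Φ h
  have h2 : (∫ s in (t + h)..(r + h), Φ s) - ∫ s in t..r, Φ s
      = (∫ s in r..(r + h), Φ s) - ∫ s in t..(t + h), Φ s := by
    have e1 := intervalIntegral.integral_add_adjacent_intervals (hi t r) (hi r (r + h))
    have e2 := intervalIntegral.integral_add_adjacent_intervals (hi t (t + h)) (hi (t + h) (r + h))
    linarith
  have h3 : ∫ s in r..(r + h), Φ s ≤ h * Φ (r + h) := by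
    have := intervalIntegral.integral_mono_on (a := r) (b := r + h) (μ := volume) (by linarith)
      (hi _ _) intervalIntegrable_const fun x hx => hmono hx.2
    simpa using this
  have h4 : 0 ≤ ∫ s in t..(t + h), Φ s :=
    intervalIntegral.integral_nonneg (by linarith) fun u hu =>
      (show Φ t = 0 by simp [hΦ]) ▸ hmono hu.1
  linarith

end Steklov

/-! ### The energy estimate for the first order backward equation. -/

section Energy

variable {V H K : Type*} [NormedAddCommGroup V] [NormedSpace ℝ V] [CompleteSpace V]
  [NormedAddCommGroup H] [InnerProductSpace ℝ H] [CompleteSpace H]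
  [NormedAddCommGroup K] [InnerProductSpace ℝ K]

/-- The energy estimate for the Steklov averages of a solution of the backward equation
`y' = D*D y + P y + G`. -/
lemma steklov_energy_estimate (A : V →L[ℝ] H) (D : V →L[ℝ] K) {S : Submodule ℝ V}
    (hS : IsClosed (S : Set V)) {T ρ : ℝ} (hρ : 0 < ρ) (P : H →L[ℝ] H)
    (hP : ∀ x, ‖P x‖ ≤ ρ * ‖x‖) {y : ℝ → H} {Y : ℝ → V} {G : ℝ → H} (hy : Continuous y)
    (hY : Integrable Y) (hYS : ∀ᵐ s ∂timeMeasure T, Y s ∈ S)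
    (hAY : ∀ᵐ s ∂timeMeasure T, A (Y s) = y s) (hG : Integrable G)
    (hG2 : Integrable fun s => ‖G s‖ ^ 2)
    (heq : ∀ φ ∈ S, ∀ a b, 0 ≤ a → a ≤ b → b ≤ T → inner ℝ (y b - y a) (A φ)
      = ∫ s in a..b, (inner ℝ (D (Y s)) (D φ) + inner ℝ (P (y s) + G s) (A φ)))
    {h t r : ℝ} (hh : 0 < h) (ht : 0 ≤ t) (htr : t ≤ r) (hr : r + h ≤ T) :
    Real.exp (3 * ρ * t) * (‖steklov h y t‖ ^ 2 + 2 * ∫ s in t..r, ‖D (steklov h Y s)‖ ^ 2)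
      ≤ Real.exp (3 * ρ * r) * (‖steklov h y r‖ ^ 2 + ρ⁻¹ * ∫ s in t..(r + h), ‖G s‖ ^ 2) := by
  have hYi : ∀ a b, IntervalIntegrable Y volume a b := fun a b => hY.intervalIntegrable
  have hyi : ∀ a b, IntervalIntegrable y volume a b := fun a b => hy.intervalIntegrable a b
  have hGi : ∀ a b, IntervalIntegrable G volume a b := fun a b => hG.intervalIntegrable
  have hG2i : ∀ a b, IntervalIntegrable (fun s => ‖G s‖ ^ 2) volume a b :=
    fun a b => hG2.intervalIntegrable
  have hIoo : ∀ {p : ℝ → Prop}, (∀ᵐ s ∂timeMeasure T, p s) → ∀ s ∈ Icc t r,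
      ∀ᵐ x ∂(volume.restrict (Ioc s (s + h))), p x := by
    intro p hp s hs
    rw [timeMeasure, restrict_Ioo_eq_restrict_Ioc] at hp
    exact ae_restrict_of_ae_restrict_of_subset
      (Ioc_subset_Ioc (ht.trans hs.1) (by linarith [hs.2])) hp
  have hmem : ∀ s ∈ Icc t r, steklov h Y s ∈ S := fun s hs =>
    steklov_mem hYi hS hh (hIoo hYS s hs)
  have hAs : ∀ s ∈ Icc t r, A (steklov h Y s) = steklov h y s := by
    intro s hs
    rw [map_steklov A hYi, steklov, steklov, intervalIntegral.integral_of_le (by linarith),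
      intervalIntegral.integral_of_le (by linarith)]
    exact congrArg _ (integral_congr_ae (hIoo hAY s hs))
  -- The averaged differential inequality. The equation on `[s, s+h]` is tested with the Steklov
  -- average at `s`; `D` and `P` commute with averaging, so the quadratic terms come out exactly. Of
  -- the `3ρ`, two come from `2⟨P n, n⟩` and one from Young's inequality with weight `ρ` for the
  -- source.
  have hdiss : ∀ s ∈ Icc t r, 2 * ‖D (steklov h Y s)‖ ^ 2 - 3 * ρ * ‖steklov h y s‖ ^ 2
      - ρ⁻¹ * (h⁻¹ * ∫ x in s..(s + h), ‖G x‖ ^ 2)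
      ≤ 2 * inner ℝ (steklov h y s) (h⁻¹ • (y (s + h) - y s)) := by
    intro s hs
    set n := steklov h y s with hn
    set φ := steklov h Y s with hφ
    have e0 := heq φ (hmem s hs) s (s + h) (ht.trans hs.1) (by linarith) (by linarith [hs.2])
    rw [hAs s hs] at e0
    have i1 : IntervalIntegrable (fun x => inner ℝ (D (Y x)) (D φ)) volume s (s + h) :=
      ((D.integrable_comp hY).inner_const (D φ)).intervalIntegrable
    have i2 : IntervalIntegrable (fun x => inner ℝ (P (y x)) n) volume s (s + h) :=
      ((P.continuous.comp hy).inner continuous_const).intervalIntegrable _ _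
    have i3 : IntervalIntegrable (fun x => inner ℝ (G x) n) volume s (s + h) :=
      (hG.inner_const n).intervalIntegrable
    have e1 : ∫ x in s..(s + h), inner ℝ (D (Y x)) (D φ) = h * ‖D φ‖ ^ 2 := by
      have : ∫ x in s..(s + h), inner ℝ (D φ) (D (Y x)) = inner ℝ (D φ) (h • D φ) := by
        have e := ((innerSL ℝ (D φ)).comp D).intervalIntegral_comp_comm (hYi s (s + h))
        simp only [ContinuousLinearMap.comp_apply, innerSL_apply_apply] at e
        rw [e, ← map_smul, hφ, steklov, smul_smul, mul_inv_cancel₀ hh.ne', one_smul]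
      rw [real_inner_smul_right, real_inner_self_eq_norm_sq] at this
      rw [← this]
      exact intervalIntegral.integral_congr fun x _ => real_inner_comm _ _
    have e2 : ∫ x in s..(s + h), inner ℝ (P (y x)) n = h * inner ℝ (P n) n := by
      have : ∫ x in s..(s + h), inner ℝ n (P (y x)) = inner ℝ n (P (h • n)) := by
        have e := ((innerSL ℝ n).comp P).intervalIntegral_comp_comm (hyi s (s + h))
        simp only [ContinuousLinearMap.comp_apply, innerSL_apply_apply] at e
        rw [e, hn, steklov, smul_smul, mul_inv_cancel₀ hh.ne', one_smul]
      rw [map_smul, real_inner_smul_right] at this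
      rw [real_inner_comm n (P n), ← this]
      exact intervalIntegral.integral_congr fun x _ => real_inner_comm _ _
    have e3 : -(ρ⁻¹ / 2 * ∫ x in s..(s + h), ‖G x‖ ^ 2) - ρ / 2 * ‖n‖ ^ 2 * h
        ≤ ∫ x in s..(s + h), inner ℝ (G x) n := by
      have hle := intervalIntegral.integral_mono_on (a := s) (b := s + h) (μ := volume)
        (f := fun x => -(ρ⁻¹ / 2 * ‖G x‖ ^ 2) - ρ / 2 * ‖n‖ ^ 2) (g := fun x => inner ℝ (G x) n)
        (by linarith) ((((hG2i s (s + h)).const_mul (ρ⁻¹ / 2)).neg).sub intervalIntegrable_const)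
        i3 (fun x _ => by
          have c1 := neg_le_of_abs_le (abs_real_inner_le_norm (G x) n)
          have c2 : ‖G x‖ * ‖n‖ ≤ ρ⁻¹ / 2 * ‖G x‖ ^ 2 + ρ / 2 * ‖n‖ ^ 2 := by
            have : 0 ≤ ρ⁻¹ / 2 * (‖G x‖ - ρ * ‖n‖) ^ 2 := by positivity
            have hexp : ρ⁻¹ / 2 * (‖G x‖ - ρ * ‖n‖) ^ 2
                = ρ⁻¹ / 2 * ‖G x‖ ^ 2 + ρ / 2 * ‖n‖ ^ 2 - ‖G x‖ * ‖n‖ := by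
              field_simp
              ring
            linarith
          linarith)
      have hsplit : ∫ x in s..(s + h), (-(ρ⁻¹ / 2 * ‖G x‖ ^ 2) - ρ / 2 * ‖n‖ ^ 2)
          = -(ρ⁻¹ / 2 * ∫ x in s..(s + h), ‖G x‖ ^ 2) - ρ / 2 * ‖n‖ ^ 2 * h := by
        have hneg : IntervalIntegrable (fun x => -(ρ⁻¹ / 2 * ‖G x‖ ^ 2)) volume s (s + h) :=
          ((hG2i s (s + h)).const_mul (ρ⁻¹ / 2)).neg
        rw [intervalIntegral.integral_sub hneg intervalIntegrable_const,
          intervalIntegral.integral_neg, intervalIntegral.integral_const_mul,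
          intervalIntegral.integral_const, add_sub_cancel_left, smul_eq_mul, mul_comm h]
      linarith
    have e4 : -(ρ * ‖n‖ ^ 2) ≤ inner ℝ (P n) n := by
      have c1 := neg_le_of_abs_le (abs_real_inner_le_norm (P n) n)
      nlinarith [mul_le_mul_of_nonneg_right (hP n) (norm_nonneg n)]
    have e5 : inner ℝ (y (s + h) - y s) n = h * ‖D φ‖ ^ 2 + (h * inner ℝ (P n) n
        + ∫ x in s..(s + h), inner ℝ (G x) n) := by
      rw [e0]
      simp only [inner_add_left]
      rw [intervalIntegral.integral_add i1 (i2.add i3), intervalIntegral.integral_add i2 i3, e1, e2]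
    rw [real_inner_smul_right, real_inner_comm, e5]
    have e6 : h⁻¹ * (h * ‖D φ‖ ^ 2 + (-(h * (ρ * ‖n‖ ^ 2))
        + (-(ρ⁻¹ / 2 * ∫ x in s..(s + h), ‖G x‖ ^ 2) - ρ / 2 * ‖n‖ ^ 2 * h)))
        ≤ h⁻¹ * (h * ‖D φ‖ ^ 2 + (h * inner ℝ (P n) n + ∫ x in s..(s + h), inner ℝ (G x) n)) := by
      refine mul_le_mul_of_nonneg_left ?_ (inv_nonneg.2 hh.le)
      nlinarith [mul_le_mul_of_nonneg_left e4 hh.le]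
    have e7 : 2 * (h⁻¹ * (h * ‖D φ‖ ^ 2 + (-(h * (ρ * ‖n‖ ^ 2))
        + (-(ρ⁻¹ / 2 * ∫ x in s..(s + h), ‖G x‖ ^ 2) - ρ / 2 * ‖n‖ ^ 2 * h))))
        = 2 * ‖D φ‖ ^ 2 - 3 * ρ * ‖n‖ ^ 2 - ρ⁻¹ * (h⁻¹ * ∫ x in s..(s + h), ‖G x‖ ^ 2) := by
      field_simp
      ring
    linarith
  -- The factor `exp (3ρs)` absorbs the term `-3ρ‖y‖²`; `q` is what remains as a lower bound for the
  -- derivative of `exp (3ρs)` times the squared norm of the average.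
  set q : ℝ → ℝ := fun s => Real.exp (3 * ρ * s) * (2 * ‖D (steklov h Y s)‖ ^ 2
      - ρ⁻¹ * (h⁻¹ * ∫ x in s..(s + h), ‖G x‖ ^ 2)) with hq
  have cD : Continuous fun s => ‖D (steklov h Y s)‖ ^ 2 :=
    (D.continuous.comp (continuous_steklov hYi h)).norm.pow 2
  have cG : Continuous fun s => ∫ x in s..(s + h), ‖G x‖ ^ 2 := continuous_integral_add hG2i h
  have cq : Continuous q := by fun_prop
  have hmono : MonotoneOn (fun x => Real.exp (3 * ρ * x) * ‖steklov h y x‖ ^ 2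
      - ∫ s in t..x, q s) (Icc t r) := by
    have hder : ∀ x, HasDerivAt (fun x => Real.exp (3 * ρ * x) * ‖steklov h y x‖ ^ 2
        - ∫ s in t..x, q s) (Real.exp (3 * ρ * x) * (3 * ρ) * ‖steklov h y x‖ ^ 2
          + Real.exp (3 * ρ * x) * (2 * inner ℝ (steklov h y x) (h⁻¹ • (y (x + h) - y x)))
          - q x) x := by
      intro x
      have d1 : HasDerivAt (fun x => Real.exp (3 * ρ * x)) (Real.exp (3 * ρ * x) * (3 * ρ)) x := by
        simpa using ((hasDerivAt_id x).const_mul (3 * ρ)).exp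
      exact (d1.mul (hasDerivAt_steklov hy h x).norm_sq).sub
        (intervalIntegral.integral_hasDerivAt_right (cq.intervalIntegrable _ _)
          (cq.stronglyMeasurableAtFilter _ _) cq.continuousAt)
    refine monotoneOn_of_deriv_nonneg (convex_Icc t r)
      (fun x _ => (hder x).continuousAt.continuousWithinAt)
      (fun x _ => (hder x).differentiableAt.differentiableWithinAt) fun x hx => ?_
    rw [(hder x).deriv]
    have := mul_le_mul_of_nonneg_left (hdiss x (interior_subset hx)) (Real.exp_pos (3 * ρ * x)).le
    simp only [hq]
    nlinarith [this]
  have hfin := hmono (left_mem_Icc.2 htr) (right_mem_Icc.2 htr) htr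
  simp only [intervalIntegral.integral_same, sub_zero] at hfin
  -- The weight is replaced by its smallest value, at `t`, on the gradient term and by its largest,
  -- at `r`, on the source term.
  have hqle : Real.exp (3 * ρ * t) * (2 * ∫ s in t..r, ‖D (steklov h Y s)‖ ^ 2)
      - Real.exp (3 * ρ * r) * (ρ⁻¹ * ∫ s in t..(r + h), ‖G s‖ ^ 2) ≤ ∫ s in t..r, q s := by
    have h1 : Real.exp (3 * ρ * t) * (2 * ∫ s in t..r, ‖D (steklov h Y s)‖ ^ 2)
        - Real.exp (3 * ρ * r) * (ρ⁻¹ * (h⁻¹ * ∫ s in t..r, ∫ x in s..(s + h), ‖G x‖ ^ 2))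
        ≤ ∫ s in t..r, q s := by
      have e : Real.exp (3 * ρ * t) * (2 * ∫ s in t..r, ‖D (steklov h Y s)‖ ^ 2)
        - Real.exp (3 * ρ * r) * (ρ⁻¹ * (h⁻¹ * ∫ s in t..r, ∫ x in s..(s + h), ‖G x‖ ^ 2))
        = ∫ s in t..r, (Real.exp (3 * ρ * t) * (2 * ‖D (steklov h Y s)‖ ^ 2)
          - Real.exp (3 * ρ * r) * (ρ⁻¹ * (h⁻¹ * ∫ x in s..(s + h), ‖G x‖ ^ 2))) := by
        rw [intervalIntegral.integral_sub]
        · simp only [intervalIntegral.integral_const_mul]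
        · exact Continuous.intervalIntegrable (by fun_prop) _ _
        · exact Continuous.intervalIntegrable (by fun_prop) _ _
      rw [e]
      refine intervalIntegral.integral_mono_on htr
        (Continuous.intervalIntegrable (by fun_prop) _ _) (cq.intervalIntegrable _ _)
        fun s hs => ?_
      have g0 : 0 ≤ ∫ x in s..(s + h), ‖G x‖ ^ 2 :=
        intervalIntegral.integral_nonneg (by linarith) fun u _ => sq_nonneg _
      have m1 : Real.exp (3 * ρ * t) ≤ Real.exp (3 * ρ * s) :=
        Real.exp_le_exp.2 (mul_le_mul_of_nonneg_left hs.1 (by positivity))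
      have m2 : Real.exp (3 * ρ * s) ≤ Real.exp (3 * ρ * r) :=
        Real.exp_le_exp.2 (mul_le_mul_of_nonneg_left hs.2 (by positivity))
      simp only [hq, mul_sub]
      exact sub_le_sub (mul_le_mul_of_nonneg_right m1 (by positivity))
        (mul_le_mul_of_nonneg_right m2 (by positivity))
    have h2 := integral_integral_add_le hG2i (fun x => sq_nonneg _) hh.le t r
    have h3 : h⁻¹ * ∫ s in t..r, ∫ x in s..(s + h), ‖G x‖ ^ 2 ≤ ∫ s in t..(r + h), ‖G s‖ ^ 2 := by
      rw [inv_mul_le_iff₀ hh]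
      exact h2
    have h4 := mul_le_mul_of_nonneg_left (mul_le_mul_of_nonneg_left h3 (inv_nonneg.2 hρ.le))
      (Real.exp_pos (3 * ρ * r)).le
    linarith
  linarith

/-- The limit `h → 0` of the averaged estimate: the terms in `y` converge by continuity, and the
gradient term passes by Fatou's lemma. The averaging window must satisfy `r + h ≤ T`, so `r < T` is
treated first, and `r = T` follows because both sides are continuous in `r`. -/
lemma energy_estimate_of_integrable (A : V →L[ℝ] H) (D : V →L[ℝ] K) {S : Submodule ℝ V}
    (hS : IsClosed (S : Set V)) {T ρ : ℝ} (hρ : 0 < ρ) (P : H →L[ℝ] H)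
    (hP : ∀ x, ‖P x‖ ≤ ρ * ‖x‖) {y : ℝ → H} {Y : ℝ → V} {G : ℝ → H} (hy : Continuous y)
    (hY : Integrable Y) (hYS : ∀ᵐ s ∂timeMeasure T, Y s ∈ S)
    (hAY : ∀ᵐ s ∂timeMeasure T, A (Y s) = y s) (hDY : Integrable fun s => ‖D (Y s)‖ ^ 2)
    (hG : Integrable G) (hG2 : Integrable fun s => ‖G s‖ ^ 2)
    (heq : ∀ φ ∈ S, ∀ a b, 0 ≤ a → a ≤ b → b ≤ T → inner ℝ (y b - y a) (A φ)
      = ∫ s in a..b, (inner ℝ (D (Y s)) (D φ) + inner ℝ (P (y s) + G s) (A φ)))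
    {t : ℝ} (ht : t ∈ Icc 0 T) :
    ‖y t‖ ^ 2 + 2 * ∫ s in t..T, ‖D (Y s)‖ ^ 2
      ≤ Real.exp (3 * ρ * (T - t)) * (‖y T‖ ^ 2 + ρ⁻¹ * ∫ s in (0 : ℝ)..T, ‖G s‖ ^ 2) := by
  have hG2i : ∀ a b, IntervalIntegrable (fun s => ‖G s‖ ^ 2) volume a b :=
    fun a b => hG2.intervalIntegrable
  have hG0 : ∀ a b : ℝ, a ≤ b → 0 ≤ ∫ s in a..b, ‖G s‖ ^ 2 := fun a b hab =>
    intervalIntegral.integral_nonneg hab fun u _ => sq_nonneg _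
  rcases ht.2.eq_or_lt with rfl | htT
  · have := mul_nonneg (inv_nonneg.2 hρ.le) (hG0 0 t ht.1)
    simpa using this
  have hGle : ∀ r, t ≤ r → r ≤ T → ∫ s in t..r, ‖G s‖ ^ 2 ≤ ∫ s in (0 : ℝ)..T, ‖G s‖ ^ 2 := by
    intro r h1 h2
    have e1 := intervalIntegral.integral_add_adjacent_intervals (hG2i 0 t) (hG2i t T)
    have e2 := intervalIntegral.integral_add_adjacent_intervals (hG2i t r) (hG2i r T)
    linarith [hG0 0 t ht.1, hG0 r T h2]
  set g := ∫ s in (0 : ℝ)..T, ‖G s‖ ^ 2 with hg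
  have hYi : ∀ a b, IntervalIntegrable Y volume a b := fun a b => hY.intervalIntegrable
  have key : ∀ r ∈ Ico t T, ‖y t‖ ^ 2 + 2 * ∫ s in t..r, ‖D (Y s)‖ ^ 2
      ≤ Real.exp (3 * ρ * (r - t)) * (‖y r‖ ^ 2 + ρ⁻¹ * g) := by
    intro r hr
    have hlim := integral_le_of_tendsto_of_integral_le (μ := volume.restrict (Ioc t r))
      (l := 𝓝[>] (0 : ℝ)) (F := fun h s => ‖D (steklov h Y s)‖ ^ 2)
      (f := fun s => ‖D (Y s)‖ ^ 2)
      (b := fun h => (Real.exp (3 * ρ * (r - t)) * (‖steklov h y r‖ ^ 2 + ρ⁻¹ * g)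
        - ‖steklov h y t‖ ^ 2) / 2)
      (B := (Real.exp (3 * ρ * (r - t)) * (‖y r‖ ^ 2 + ρ⁻¹ * g) - ‖y t‖ ^ 2) / 2)
      (fun _ _ => sq_nonneg _)
      (fun h => (((D.continuous.comp (continuous_steklov hYi h)).norm.pow
        2).continuousOn.integrableOn_compact isCompact_Icc).mono_set Ioc_subset_Icc_self)
      (fun _ => sq_nonneg _) hDY.integrableOn
      (by
        filter_upwards [ae_restrict_of_ae (ae_tendsto_steklov hY)] with s hs
        exact ((D.continuous.tendsto _).comp hs).norm.pow 2)
      (by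
        filter_upwards [Ioo_mem_nhdsGT (show (0 : ℝ) < T - r by linarith [hr.2])] with h hh
        have e := steklov_energy_estimate A D hS hρ P hP hy hY hYS hAY hG hG2 heq hh.1 ht.1 hr.1
          (by linarith [hh.2])
        have e2 : Real.exp (3 * ρ * r) = Real.exp (3 * ρ * t) * Real.exp (3 * ρ * (r - t)) := by
          rw [← Real.exp_add]
          ring_nf
        rw [e2, mul_assoc (Real.exp _)] at e
        have e3 := le_of_mul_le_mul_left e (Real.exp_pos _)
        have e4 := mul_le_mul_of_nonneg_left (mul_le_mul_of_nonneg_left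
          (hGle (r + h) (by linarith [hr.1, hh.1]) (by linarith [hh.2])) (inv_nonneg.2 hρ.le))
          (Real.exp_pos (3 * ρ * (r - t))).le
        rw [← intervalIntegral.integral_of_le hr.1]
        linarith)
      (by
        have c1 := (tendsto_steklov_of_continuous hy r).norm.pow 2
        have c2 := (tendsto_steklov_of_continuous hy t).norm.pow 2
        exact (((c1.add_const _).const_mul _).sub c2).div_const 2)
    rw [← intervalIntegral.integral_of_le hr.1] at hlim
    linarith
  have hcL : Continuous fun r => ‖y t‖ ^ 2 + 2 * ∫ s in t..r, ‖D (Y s)‖ ^ 2 :=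
    continuous_const.add (continuous_const.mul
      (intervalIntegral.continuous_primitive (fun a b => hDY.intervalIntegrable) t))
  have hcR : Continuous fun r => Real.exp (3 * ρ * (r - t)) * (‖y r‖ ^ 2 + ρ⁻¹ * g) := by fun_prop
  have hcl := (isClosed_le hcL hcR).closure_subset_iff.2 (show Ico t T ⊆ _ from key)
  rw [closure_Ico htT.ne] at hcl
  exact hcl (right_mem_Icc.2 htT.le)

lemma MeasureTheory.MemLp.integrable_indicator_Ioo {X : Type*} [NormedAddCommGroup X] {T : ℝ}
    {f : ℝ → X} (hf : MemLp f 2 (timeMeasure T)) : Integrable ((Ioo 0 T).indicator f) :=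
  (integrable_indicator_iff measurableSet_Ioo).2 (hf.integrable (by norm_num))

lemma MeasureTheory.MemLp.integrable_norm_sq_indicator_Ioo {X : Type*} [NormedAddCommGroup X]
    {T : ℝ} {f : ℝ → X} (hf : MemLp f 2 (timeMeasure T)) :
    Integrable (fun s => ‖(Ioo 0 T).indicator f s‖ ^ 2) := by
  refine ((integrable_indicator_iff measurableSet_Ioo).2
    (hf.integrable_norm_pow (p := 2) (by norm_num))).congr (Eventually.of_forall fun s => ?_)
  by_cases hs : s ∈ Ioo 0 T <;> simp [hs]

lemma intervalIntegral_congr_Ioo {F F' : ℝ → ℝ} {T : ℝ} (hF : ∀ s ∈ Ioo 0 T, F s = F' s) (a b : ℝ)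
    (ha : 0 ≤ a) (hab : a ≤ b) (hb : b ≤ T) : ∫ s in a..b, F s = ∫ s in a..b, F' s := by
  rw [intervalIntegral.integral_of_le hab, intervalIntegral.integral_of_le hab,
    integral_Ioc_eq_integral_Ioo, integral_Ioc_eq_integral_Ioo]
  exact setIntegral_congr_fun measurableSet_Ioo fun s hs =>
    hF s ⟨ha.trans_lt hs.1, hs.2.trans_le hb⟩

/-- The energy estimate for the backward equation `y' = D*D y + P y + G`, tested with a closed
subspace `S`. -/
lemma energy_estimate (A : V →L[ℝ] H) (D : V →L[ℝ] K) {S : Submodule ℝ V}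
    (hS : IsClosed (S : Set V)) {T ρ : ℝ} (hρ : 0 < ρ) (P : H →L[ℝ] H)
    (hP : ∀ x, ‖P x‖ ≤ ρ * ‖x‖) {y : ℝ → H} {Y : ℝ → V} {G : ℝ → H}
    (hy : ContinuousOn y (Icc 0 T)) (hY : MemLp Y 2 (timeMeasure T))
    (hYS : ∀ᵐ s ∂timeMeasure T, Y s ∈ S) (hAY : ∀ᵐ s ∂timeMeasure T, A (Y s) = y s)
    (hG : MemLp G 2 (timeMeasure T))
    (heq : ∀ φ ∈ S, ∀ a b, 0 ≤ a → a ≤ b → b ≤ T → inner ℝ (y b - y a) (A φ)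
      = ∫ s in a..b, (inner ℝ (D (Y s)) (D φ) + inner ℝ (P (y s) + G s) (A φ)))
    {t : ℝ} (ht : t ∈ Icc 0 T) :
    ‖y t‖ ^ 2 + 2 * ∫ s in t..T, ‖D (Y s)‖ ^ 2
      ≤ Real.exp (3 * ρ * (T - t)) * (‖y T‖ ^ 2 + ρ⁻¹ * ∫ s in (0 : ℝ)..T, ‖G s‖ ^ 2) := by
  have hT : 0 ≤ T := ht.1.trans ht.2
  -- Averages need functions on all of `ℝ`: `y` is extended by its endpoint values, `Y` and `G` by
  -- zero. Integrals over subintervals of `[0, T]` see only the open interval and do not change.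
  set y' : ℝ → H := IccExtend hT ((Icc 0 T).domRestrict y) with hy'
  have hyy : ∀ s ∈ Icc 0 T, y' s = y s := fun s hs => IccExtend_of_mem hT _ hs
  set Y' := (Ioo 0 T).indicator Y with hY'
  set G' := (Ioo 0 T).indicator G with hG'
  have hDYm : MemLp (fun s => D (Y s)) 2 (timeMeasure T) := D.comp_memLp' hY
  have main := energy_estimate_of_integrable A D hS hρ P hP (y := y') (Y := Y') (G := G')
    (T := T) hy.domRestrict.Icc_extend' hY.integrable_indicator_Ioo
    (by
      filter_upwards [hYS, ae_restrict_mem measurableSet_Ioo] with s h1 h2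
      rwa [hY', indicator_of_mem h2])
    (by
      filter_upwards [hAY, ae_restrict_mem measurableSet_Ioo] with s h1 h2
      rw [hY', indicator_of_mem h2, h1, hyy s (Ioo_subset_Icc_self h2)])
    (hDYm.integrable_norm_sq_indicator_Ioo.congr (Eventually.of_forall fun s => by
      by_cases hs : s ∈ Ioo 0 T <;> simp [hY', hs]))
    hG.integrable_indicator_Ioo hG.integrable_norm_sq_indicator_Ioo
    (by
      intro φ hφ a b ha hab hb
      rw [hyy b ⟨ha.trans hab, hb⟩, hyy a ⟨ha, hab.trans hb⟩, heq φ hφ a b ha hab hb]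
      refine intervalIntegral_congr_Ioo (fun s hs => ?_) a b ha hab hb
      rw [hY', hG', indicator_of_mem hs, indicator_of_mem hs, hyy s (Ioo_subset_Icc_self hs)]) ht
  rw [hyy t ht, hyy T ⟨hT, le_rfl⟩] at main
  rw [intervalIntegral_congr_Ioo (F := fun s => ‖D (Y s)‖ ^ 2) (F' := fun s => ‖D (Y' s)‖ ^ 2)
      (fun s hs => by rw [hY', indicator_of_mem hs]) t T ht.1 ht.2 le_rfl,
    intervalIntegral_congr_Ioo (F := fun s => ‖G s‖ ^ 2) (F' := fun s => ‖G' s‖ ^ 2)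
      (fun s hs => by rw [hG', indicator_of_mem hs]) 0 T le_rfl hT le_rfl]
  exact main

end Energy

/-- Backward Grönwall inequality in integral form. -/
lemma le_mul_exp_of_le_add_integral {v : ℝ → ℝ} (hv : Continuous v) {t T β : ℝ} (htT : t ≤ T)
    (h : ∀ s ∈ Icc t T, v s ≤ β + ∫ r in s..T, v r) : v t ≤ β * Real.exp (T - t) := by
  have hder : ∀ x, HasDerivAt (fun x => Real.exp x * (β + ∫ r in x..T, v r))
      (Real.exp x * (β + ∫ r in x..T, v r) + Real.exp x * (-v x)) x := fun x =>
    (Real.hasDerivAt_exp x).mul ((intervalIntegral.integral_hasDerivAt_left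
      (hv.intervalIntegrable _ _) (hv.stronglyMeasurableAtFilter _ _) hv.continuousAt).const_add β)
  -- The derivative is `exp x * (β + ∫_x^T v - v x)`, and the assumed inequality says exactly that
  -- it is nonnegative.
  have hmono : MonotoneOn (fun x => Real.exp x * (β + ∫ r in x..T, v r)) (Icc t T) := by
    refine monotoneOn_of_deriv_nonneg (convex_Icc t T)
      (fun x _ => (hder x).continuousAt.continuousWithinAt)
      (fun x _ => (hder x).differentiableAt.differentiableWithinAt) fun x hx => ?_
    rw [(hder x).deriv, ← mul_add]
    have := h x (interior_subset hx)
    exact mul_nonneg (Real.exp_pos x).le (by linarith)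
  have h1 := hmono (left_mem_Icc.2 htT) (right_mem_Icc.2 htT) htT
  simp only [intervalIntegral.integral_same, add_zero] at h1
  have h2 := mul_le_mul_of_nonneg_left (h t (left_mem_Icc.2 htT)) (Real.exp_pos t).le
  have h3 : Real.exp T = Real.exp t * Real.exp (T - t) := by
    rw [← Real.exp_add]
    ring_nf
  have h4 : Real.exp t * v t ≤ Real.exp t * (β * Real.exp (T - t)) := by
    rw [h3] at h1
    linarith
  exact le_of_mul_le_mul_left h4 (Real.exp_pos t)

/-! ### Time regularity and boundary values of weak solutions. -/

section Evolution

variable {d : ℕ} {Ω : Set (E d)} {T : ℝ}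

lemma intervalIntegrable_of_integrable_timeMeasure {X : Type*} [NormedAddCommGroup X] {f : ℝ → X}
    (hf : Integrable f (timeMeasure T)) {a b : ℝ} (ha : 0 ≤ a) (hab : a ≤ b) (hb : b ≤ T) :
    IntervalIntegrable f volume a b := by
  rw [intervalIntegrable_iff_integrableOn_Ioo_of_le hab]
  exact IntegrableOn.mono_set hf (Ioo_subset_Ioo ha hb)

lemma ae_restrict_uIoc_of_ae_timeMeasure {p : ℝ → Prop} (h : ∀ᵐ s ∂timeMeasure T, p s) {a b : ℝ}
    (ha : 0 ≤ a) (hab : a ≤ b) (hb : b ≤ T) : ∀ᵐ s ∂(volume.restrict (uIoc a b)), p s := by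
  rw [uIoc_of_le hab, ← restrict_Ioo_eq_restrict_Ioc]
  exact ae_restrict_of_ae_restrict_of_subset (Ioo_subset_Ioo ha hb) h

lemma ContinuousOn.memLp_timeMeasure {X : Type*} [NormedAddCommGroup X] {f : ℝ → X}
    (hf : ContinuousOn f (Icc 0 T)) : MemLp f 2 (timeMeasure T) := by
  obtain ⟨c, hc⟩ := isCompact_Icc.exists_bound_of_continuousOn hf
  refine MemLp.of_bound ((hf.aestronglyMeasurable_of_isCompact isCompact_Icc
    measurableSet_Icc).mono_measure (Measure.restrict_mono Ioo_subset_Icc_self le_rfl)) c ?_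
  filter_upwards [ae_restrict_mem measurableSet_Ioo] with s hs
  exact hc s (Ioo_subset_Icc_self hs)

lemma integrable_apply_of_memLp {V : Type*} {_ : NormedAddCommGroup V} {_ : NormedSpace ℝ V}
    {T : ℝ} {g : ℝ → StrongDual ℝ V} (hg : MemLp g 2 (timeMeasure T)) (φ : V) :
    Integrable (fun s => g s φ) (timeMeasure T) :=
  ContinuousLinearMap.integrable_comp
    (ContinuousLinearMap.apply ℝ ℝ φ : StrongDual ℝ V →L[ℝ] ℝ) (hg.integrable (by norm_num))

lemma QuasiRev.HasWeakTimeDeriv.integral_apply_eq_sub {V : Type*} {_ : NormedAddCommGroup V}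
    {_ : NormedSpace ℝ V} {T : ℝ} {f g : ℝ → StrongDual ℝ V} (h : HasWeakTimeDeriv T f g)
    (hf : ContinuousOn f (Icc 0 T)) (hg : MemLp g 2 (timeMeasure T)) (φ : V) {a b : ℝ}
    (ha : 0 ≤ a) (hab : a ≤ b) (hb : b ≤ T) : ∫ s in a..b, g s φ = f b φ - f a φ := by
  have e := (ContinuousLinearMap.apply ℝ ℝ φ : StrongDual ℝ V →L[ℝ] ℝ).intervalIntegral_comp_comm
    (intervalIntegrable_of_integrable_timeMeasure (hg.integrable (by norm_num)) ha hab hb)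
  simp only [ContinuousLinearMap.apply_apply] at e
  rw [e, h.integral_eq_sub hf (hg.integrable (by norm_num)) ha hab hb, sub_apply]

namespace QuasiRev.Evolution

lemma integral_vel (u : Evolution Ω T) {a b : ℝ} (ha : 0 ≤ a) (hab : a ≤ b) (hb : b ≤ T) :
    ∫ s in a..b, u.vel s = toL2 (u.pos b) - toL2 (u.pos a) :=
  u.deriv_pos.integral_eq_sub (toL2.continuous.comp_continuousOn u.continuousOn_pos)
    (u.continuousOn_vel.memLp_timeMeasure.integrable (by norm_num)) ha hab hb

/-- The weak derivative is given only in `L²`. As `toL2` commutes with the integral and is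
injective, the identity lifts to `H¹`. -/
lemma integral_velH1 (hΩ : IsOpen Ω) (u : Evolution Ω T) {a b : ℝ} (ha : 0 ≤ a) (hab : a ≤ b)
    (hb : b ≤ T) : ∫ s in a..b, u.velH1 s = u.pos b - u.pos a := by
  refine toL2_injective hΩ ?_
  rw [map_sub, ← u.integral_vel ha hab hb, ← toL2.intervalIntegral_comp_comm
    (intervalIntegrable_of_integrable_timeMeasure (u.memLp_velH1.integrable (by norm_num))
      ha hab hb)]
  exact intervalIntegral.integral_congr_ae_restrict
    (ae_restrict_uIoc_of_ae_timeMeasure u.velH1_eq ha hab hb)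

lemma integral_acc (u : Evolution Ω T) (φ : H10 Ω) {a b : ℝ} (ha : 0 ≤ a) (hab : a ≤ b)
    (hb : b ≤ T) : ∫ s in a..b, u.acc s φ = inner ℝ (u.vel b) (toL2 (φ : H1 Ω))
      - inner ℝ (u.vel a) (toL2 (φ : H1 Ω)) :=
  u.deriv_vel.integral_apply_eq_sub (continuous_toHm1.comp_continuousOn u.continuousOn_vel)
    u.memLp_acc φ ha hab hb

lemma intervalIntegrable_acc_add_inner_vel (u : Evolution Ω T) (φ : H10 Ω) {a b : ℝ} (ha : 0 ≤ a)
    (hab : a ≤ b) (hb : b ≤ T) : IntervalIntegrable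
      (fun s => u.acc s φ + inner ℝ (u.vel s) (toL2 (φ : H1 Ω))) volume a b :=
  intervalIntegrable_of_integrable_timeMeasure
    ((integrable_apply_of_memLp u.memLp_acc φ).add
      ((u.continuousOn_vel.memLp_timeMeasure.integrable (by norm_num)).inner_const _)) ha hab hb

/-- The function `u + u_t` is absolutely continuous with values in `H⁻¹(Ω)`. -/
lemma inner_sub_eq_integral (u : Evolution Ω T) (φ : H10 Ω) {a b : ℝ} (ha : 0 ≤ a) (hab : a ≤ b)
    (hb : b ≤ T) :
    inner ℝ ((toL2 (u.pos b) + u.vel b) - (toL2 (u.pos a) + u.vel a)) (toL2 (φ : H1 Ω))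
      = ∫ s in a..b, (u.acc s φ + inner ℝ (u.vel s) (toL2 (φ : H1 Ω))) := by
  have i2 : IntervalIntegrable u.vel volume a b :=
    intervalIntegrable_of_integrable_timeMeasure
      (u.continuousOn_vel.memLp_timeMeasure.integrable (by norm_num)) ha hab hb
  have e2 := (innerSL ℝ (toL2 (φ : H1 Ω))).intervalIntegral_comp_comm i2
  simp only [innerSL_apply_apply] at e2
  have j1 : IntervalIntegrable (fun s => u.acc s φ) volume a b :=
    intervalIntegrable_of_integrable_timeMeasure (integrable_apply_of_memLp u.memLp_acc φ)
      ha hab hb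
  have j2 : IntervalIntegrable (fun s => inner ℝ (u.vel s) (toL2 (φ : H1 Ω))) volume a b :=
    intervalIntegrable_of_integrable_timeMeasure
      ((u.continuousOn_vel.memLp_timeMeasure.integrable (by norm_num)).inner_const _) ha hab hb
  have e3 : ∫ s in a..b, inner ℝ (u.vel s) (toL2 (φ : H1 Ω))
      = inner ℝ (toL2 (u.pos b) - toL2 (u.pos a)) (toL2 (φ : H1 Ω)) := by
    rw [← u.integral_vel ha hab hb, real_inner_comm, ← e2]
    exact intervalIntegral.integral_congr fun x _ => real_inner_comm _ _
  rw [intervalIntegral.integral_add j1 j2, e3, u.integral_acc φ ha hab hb, ← inner_sub_left, ← inner_add_left]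
  congr 1
  abel

/-- Almost every time is a dense set of times, so continuity in `H¹` and closedness of `H¹₀` extend
the boundary condition to every time. -/
lemma pos_mem_H10 (u : Evolution Ω T) (hT : 0 < T) {t : ℝ} (ht : t ∈ Icc 0 T) :
    u.pos t ∈ H10 Ω := by
  have hae : ∀ᵐ s : ℝ, s ∈ Ioo 0 T → u.pos s ∈ H10 Ω :=
    (ae_restrict_iff' measurableSet_Ioo).1 u.pos_mem
  have hd : Dense {s : ℝ | s ∈ Ioo 0 T → u.pos s ∈ H10 Ω} := Measure.dense_of_ae hae
  have hcl : Icc 0 T ⊆ closure (Ioo 0 T ∩ {s : ℝ | s ∈ Ioo 0 T → u.pos s ∈ H10 Ω}) := by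
    rw [← closure_Ioo hT.ne]
    exact closure_minimal (hd.open_subset_closure_inter isOpen_Ioo) isClosed_closure
  have := ((u.continuousOn_pos t ht).mono
    (inter_subset_left.trans Ioo_subset_Icc_self)).mem_closure (hcl ht)
    (t := (H10 Ω : Set (H1 Ω))) fun s hs => hs.2 hs.1
  rwa [(isClosed_H10 Ω).closure_eq] at this

/-- The definition places `u_t` only in `H¹`. At a Lebesgue point it is the limit of the quotients
`(u(t+h) - u(t))/h`, which lie in the closed subspace `H¹₀`. This makes `w + w_t` an admissible test
function and lets the relation between `P`, `Δ` and `Q` be applied to `u_t`. -/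
lemma velH1_mem_H10 (hΩ : IsOpen Ω) (u : Evolution Ω T) (hT : 0 < T) :
    ∀ᵐ t ∂timeMeasure T, u.velH1 t ∈ H10 Ω := by
  filter_upwards [ae_restrict_of_ae (ae_tendsto_steklov u.memLp_velH1.integrable_indicator_Ioo),
    ae_restrict_mem measurableSet_Ioo] with t ht htT
  rw [indicator_of_mem htT] at ht
  refine (isClosed_H10 Ω).mem_of_tendsto ht ?_
  filter_upwards [Ioo_mem_nhdsGT (show (0 : ℝ) < T - t by linarith [htT.2])] with h hh
  have e : ∫ s in t..(t + h), (Ioo 0 T).indicator u.velH1 s = ∫ s in t..(t + h), u.velH1 s := by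
    rw [intervalIntegral.integral_of_le (by linarith [hh.1]),
      intervalIntegral.integral_of_le (by linarith [hh.1])]
    refine setIntegral_congr_fun measurableSet_Ioc fun s hs => indicator_of_mem ?_ _
    exact ⟨htT.1.trans hs.1, by linarith [hs.2, hh.2]⟩
  rw [steklov, e, u.integral_velH1 hΩ htT.1.le (by linarith [hh.1]) (by linarith [hh.2])]
  exact (H10 Ω).smul_mem _ ((H10 Ω).sub_mem
    (u.pos_mem_H10 hT ⟨by linarith [hh.1, htT.1], by linarith [hh.2]⟩)
    (u.pos_mem_H10 hT (Ioo_subset_Icc_self htT)))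

end QuasiRev.Evolution

/-! ### From bounds for `w + w_t` to bounds for `w`. -/

/-- The Cauchy–Schwarz inequality on an interval. -/
lemma sq_integral_le_mul_integral_sq {f : ℝ → ℝ} {a b : ℝ} (hab : a ≤ b)
    (hf : IntervalIntegrable f volume a b) (hf2 : IntervalIntegrable (fun s => f s ^ 2) volume a b) :
    (∫ s in a..b, f s) ^ 2 ≤ (b - a) * ∫ s in a..b, f s ^ 2 := by
  rcases hab.eq_or_lt with rfl | hlt
  · simp
  have hL : 0 < b - a := by linarith
  set I := ∫ s in a..b, f s with hI
  have h0 : 0 ≤ ∫ s in a..b, (f s - I / (b - a)) ^ 2 :=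
    intervalIntegral.integral_nonneg hab fun _ _ => sq_nonneg _
  have h1 : ∫ s in a..b, (f s - I / (b - a)) ^ 2
      = (∫ s in a..b, f s ^ 2) - 2 * (I / (b - a)) * I + (b - a) * (I / (b - a)) ^ 2 := by
    have : ∀ s, (f s - I / (b - a)) ^ 2
        = f s ^ 2 - 2 * (I / (b - a)) * f s + (I / (b - a)) ^ 2 := fun s => by ring
    simp only [this]
    rw [intervalIntegral.integral_add (hf2.sub (hf.const_mul _)) intervalIntegrable_const,
      intervalIntegral.integral_sub hf2 (hf.const_mul _), intervalIntegral.integral_const_mul,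
      intervalIntegral.integral_const, smul_eq_mul]
  rw [h1] at h0
  have h2 : (b - a) * ((∫ s in a..b, f s ^ 2) - 2 * (I / (b - a)) * I
      + (b - a) * (I / (b - a)) ^ 2) = (b - a) * (∫ s in a..b, f s ^ 2) - I ^ 2 := by
    field_simp
    ring
  have h3 := mul_nonneg hL.le h0
  rw [h2] at h3
  linarith

/-- If `W' = Y - W`, bounds for `toL2 Y` and `grad Y` give bounds for `W` and `W'`. -/
lemma bounds_of_energy {W Z : ℝ → H1 Ω} {B : ℝ → ℝ} (hW : ContinuousOn W (Icc 0 T))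
    (hZ : MemLp Z 2 (timeMeasure T))
    (hWZ : ∀ a b, 0 ≤ a → a ≤ b → b ≤ T → ∫ s in a..b, Z s = W b - W a) {y : ℝ → L2 Ω}
    (hyY : ∀ᵐ s ∂timeMeasure T, toL2 (W s + Z s) = y s)
    (hB : ∀ s ∈ Icc 0 T, ‖y s‖ ^ 2 + 2 * ∫ r in s..T, ‖grad (W r + Z r)‖ ^ 2 ≤ B s)
    (hanti : AntitoneOn B (Icc 0 T)) {t : ℝ} (ht : t ∈ Icc 0 T) :
    ‖W t‖ ^ 2 ≤ 2 * Real.exp T ^ 2 * (‖W T‖ ^ 2 + T * (T + 1) * B t) := by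
  have hT : 0 ≤ T := ht.1.trans ht.2
  have hYm : MemLp (fun s => W s + Z s) 2 (timeMeasure T) := hW.memLp_timeMeasure.add hZ
  have hDm : MemLp (fun s => grad (W s + Z s)) 2 (timeMeasure T) := grad.comp_memLp' hYm
  have iY : ∀ s ∈ Icc t T, IntervalIntegrable (fun r => ‖W r + Z r‖) volume s T := fun s hs =>
    intervalIntegrable_of_integrable_timeMeasure (hYm.integrable (by norm_num)).norm
      (ht.1.trans hs.1) hs.2 le_rfl
  have iY2 : IntervalIntegrable (fun r => ‖W r + Z r‖ ^ 2) volume t T :=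
    intervalIntegrable_of_integrable_timeMeasure
      (hYm.integrable_norm_pow (p := 2) (by norm_num)) ht.1 ht.2 le_rfl
  have iD2 : IntervalIntegrable (fun r => ‖grad (W r + Z r)‖ ^ 2) volume t T :=
    intervalIntegrable_of_integrable_timeMeasure
      (hDm.integrable_norm_pow (p := 2) (by norm_num)) ht.1 ht.2 le_rfl
  have hD0 : ∀ s ∈ Icc 0 T, 0 ≤ ∫ r in s..T, ‖grad (W r + Z r)‖ ^ 2 := fun s hs =>
    intervalIntegral.integral_nonneg hs.2 fun _ _ => sq_nonneg _
  have hB0 : 0 ≤ B t := by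
    have := hB t ht
    have := hD0 t ht
    nlinarith [sq_nonneg ‖y t‖]
  -- The `L²` part is bounded pointwise, `‖y r‖² ≤ B r ≤ B t`, and contributes `(T - t) B t`; the
  -- gradient part is already integrated in the energy bound at `t`.
  have hY2 : ∫ r in t..T, ‖W r + Z r‖ ^ 2 ≤ (T + 1) * B t := by
    have hle : ∫ r in t..T, ‖W r + Z r‖ ^ 2 ≤ ∫ r in t..T, (B t + ‖grad (W r + Z r)‖ ^ 2) := by
      refine intervalIntegral.integral_mono_ae_restrict ht.2 iY2 (intervalIntegrable_const.add iD2) ?_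
      rw [Measure.restrict_congr_set Ioo_ae_eq_Icc.symm]
      filter_upwards [ae_restrict_of_ae_restrict_of_subset (Ioo_subset_Ioo_left ht.1) hyY,
        ae_restrict_mem measurableSet_Ioo] with r hr hrT
      have hr' : r ∈ Icc 0 T := ⟨ht.1.trans hrT.1.le, hrT.2.le⟩
      have h1 := hB r hr'
      have h2 := hD0 r hr'
      have h3 := hanti ht hr' hrT.1.le
      rw [norm_sq_eq_toL2_add_grad, hr]
      linarith
    rw [intervalIntegral.integral_add intervalIntegrable_const iD2,
      intervalIntegral.integral_const, smul_eq_mul] at hle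
    have h1 := hB t ht
    have h2 : (T - t) * B t ≤ T * B t := mul_le_mul_of_nonneg_right (by linarith [ht.1]) hB0
    nlinarith [sq_nonneg ‖y t‖]
  set I := ∫ r in t..T, ‖W r + Z r‖ with hI
  have hI0 : 0 ≤ I := intervalIntegral.integral_nonneg ht.2 fun _ _ => norm_nonneg _
  have hI2 : I ^ 2 ≤ T * (T + 1) * B t := by
    have h1 := sq_integral_le_mul_integral_sq ht.2 (iY t ⟨le_rfl, ht.2⟩) iY2
    have h2 : (T - t) * ∫ r in t..T, ‖W r + Z r‖ ^ 2 ≤ T * ((T + 1) * B t) :=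
      mul_le_mul (by linarith [ht.1]) hY2
        (intervalIntegral.integral_nonneg ht.2 fun _ _ => sq_nonneg _) hT
    linarith
  set v : ℝ → ℝ := IccExtend hT ((Icc 0 T).domRestrict fun s => ‖W s‖) with hv
  have hvW : ∀ s ∈ Icc 0 T, v s = ‖W s‖ := fun s hs => IccExtend_of_mem hT _ hs
  have hvc : Continuous v := hW.norm.domRestrict.Icc_extend'
  -- Grönwall applied to `W s = W T - ∫_s^T (Y - W)` with `Y = W + Z`: the integral of `‖Y‖` goes
  -- into the constant, and that of `‖W‖` is the feedback term.
  have hgron := le_mul_exp_of_le_add_integral hvc (β := ‖W T‖ + I) ht.2 fun s hs => by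
    have hs' : s ∈ Icc 0 T := ⟨ht.1.trans hs.1, hs.2⟩
    have iZ : IntervalIntegrable Z volume s T :=
      intervalIntegrable_of_integrable_timeMeasure (hZ.integrable (by norm_num)) hs'.1 hs.2 le_rfl
    have e1 : W s = W T - ∫ r in s..T, Z r := by
      rw [hWZ s T hs'.1 hs.2 le_rfl]
      abel
    have e2 : ‖∫ r in s..T, Z r‖ ≤ ∫ r in s..T, (‖W r + Z r‖ + v r) := by
      refine (intervalIntegral.norm_integral_le_integral_norm hs.2).trans ?_
      refine intervalIntegral.integral_mono_on hs.2 iZ.norm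
        ((iY s hs).add (hvc.intervalIntegrable _ _)) fun r hr => ?_
      rw [hvW r ⟨hs'.1.trans hr.1, hr.2⟩]
      have : Z r = (W r + Z r) - W r := by abel
      calc ‖Z r‖ = ‖(W r + Z r) - W r‖ := congrArg _ this
        _ ≤ _ := norm_sub_le _ _
    rw [intervalIntegral.integral_add (iY s hs) (hvc.intervalIntegrable _ _)] at e2
    have e3 : ∫ r in s..T, ‖W r + Z r‖ ≤ I := by
      have iYts : IntervalIntegrable (fun r => ‖W r + Z r‖) volume t s :=
        intervalIntegrable_of_integrable_timeMeasure (hYm.integrable (by norm_num)).norm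
          ht.1 hs.1 hs.2
      have := intervalIntegral.integral_add_adjacent_intervals iYts (iY s hs)
      have h0 : 0 ≤ ∫ r in t..s, ‖W r + Z r‖ :=
        intervalIntegral.integral_nonneg hs.1 fun _ _ => norm_nonneg _
      linarith
    have e4 : ‖W s‖ ≤ ‖W T‖ + ‖∫ r in s..T, Z r‖ :=
      (congrArg norm e1).trans_le (norm_sub_le _ _)
    rw [hvW s hs']
    linarith
  rw [hvW t ht] at hgron
  have hexp : Real.exp (T - t) ≤ Real.exp T := Real.exp_le_exp.2 (by linarith [ht.1])
  have h1 : ‖W t‖ ≤ (‖W T‖ + I) * Real.exp T :=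
    hgron.trans (mul_le_mul_of_nonneg_left hexp (by positivity))
  calc ‖W t‖ ^ 2 ≤ ((‖W T‖ + I) * Real.exp T) ^ 2 := pow_le_pow_left₀ (norm_nonneg _) h1 2
    _ = Real.exp T ^ 2 * (‖W T‖ + I) ^ 2 := by ring
    _ ≤ Real.exp T ^ 2 * (2 * (‖W T‖ ^ 2 + T * (T + 1) * B t)) := by
        refine mul_le_mul_of_nonneg_left ?_ (sq_nonneg _)
        nlinarith [sq_nonneg (‖W T‖ - I)]
    _ = _ := by ring

end Evolution

/-! ### The difference of the regularized and the exact solution. -/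

section Difference

variable {d : ℕ} {Ω : Set (E d)} {T : ℝ}

/-- If `W' = Y - W`, bounds for `W` and `Y` give a bound for the energy of `W'`. -/
lemma velocity_bound_of_bounds {W Z : ℝ → H1 Ω} (hW : ContinuousOn W (Icc 0 T))
    (hZ : MemLp Z 2 (timeMeasure T)) {y v : L2 Ω} {t B N : ℝ} (ht : t ∈ Icc 0 T)
    (hB : ‖y‖ ^ 2 + 2 * ∫ r in t..T, ‖grad (W r + Z r)‖ ^ 2 ≤ B) (hyv : y = toL2 (W t) + v)
    (hN : ∀ s ∈ Icc t T, ‖W s‖ ^ 2 ≤ N) :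
    ‖v‖ ^ 2 + ∫ s in t..T, ‖grad (Z s)‖ ^ 2 ≤ 2 * B + 2 * (1 + T) * N := by
  have hYm : MemLp (fun s => grad (W s + Z s)) 2 (timeMeasure T) :=
    grad.comp_memLp' (hW.memLp_timeMeasure.add hZ)
  have iY : IntervalIntegrable (fun r => ‖grad (W r + Z r)‖ ^ 2) volume t T :=
    intervalIntegrable_of_integrable_timeMeasure
      (hYm.integrable_norm_pow (p := 2) (by norm_num)) ht.1 ht.2 le_rfl
  have iZ : IntervalIntegrable (fun r => ‖grad (Z r)‖ ^ 2) volume t T :=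
    intervalIntegrable_of_integrable_timeMeasure
      ((grad.comp_memLp' hZ).integrable_norm_pow (p := 2) (by norm_num)) ht.1 ht.2 le_rfl
  have hN0 : 0 ≤ N := (sq_nonneg _).trans (hN t ⟨le_rfl, ht.2⟩)
  have h1 : ∫ s in t..T, ‖grad (Z s)‖ ^ 2
      ≤ ∫ s in t..T, (2 * ‖grad (W s + Z s)‖ ^ 2 + 2 * N) := by
    refine intervalIntegral.integral_mono_on ht.2 iZ
      ((iY.const_mul 2).add intervalIntegrable_const) fun s hs => ?_
    have e : grad (Z s) = grad (W s + Z s) - grad (W s) := by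
      rw [map_add]
      abel
    have e1 : ‖grad (Z s)‖ ≤ ‖grad (W s + Z s)‖ + ‖W s‖ := by
      rw [e]
      exact (norm_sub_le _ _).trans (by linarith [norm_grad_le (W s)])
    have e2 := pow_le_pow_left₀ (norm_nonneg _) e1 2
    nlinarith [sq_nonneg (‖grad (W s + Z s)‖ - ‖W s‖), hN s hs]
  rw [intervalIntegral.integral_add (iY.const_mul 2) intervalIntegrable_const,
    intervalIntegral.integral_const_mul, intervalIntegral.integral_const, smul_eq_mul] at h1
  have h2 : ‖v‖ ^ 2 ≤ 2 * ‖y‖ ^ 2 + 2 * N := by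
    have e : v = y - toL2 (W t) := by
      rw [hyv]
      abel
    have e1 : ‖v‖ ≤ ‖y‖ + ‖W t‖ := by
      rw [e]
      exact (norm_sub_le _ _).trans (by linarith [norm_toL2_le (W t)])
    have e2 := pow_le_pow_left₀ (norm_nonneg _) e1 2
    nlinarith [sq_nonneg (‖y‖ - ‖W t‖), hN t ⟨le_rfl, ht.2⟩]
  have h3 : (T - t) * (2 * N) ≤ T * (2 * N) :=
    mul_le_mul_of_nonneg_right (by linarith [ht.1]) (by linarith)
  have h4 : 0 ≤ ∫ r in t..T, ‖grad (W r + Z r)‖ ^ 2 :=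
    intervalIntegral.integral_nonneg ht.2 fun _ _ => sq_nonneg _
  nlinarith

/-- The equation satisfied by the difference of a regularized and an exact solution. -/
lemma difference_equation (hΩ : IsOpen Ω) (hT : 0 < T) {W : Type*} [NormedAddCommGroup W]
    [NormedSpace ℝ W] {ι : W →ₗ[ℝ] L2 Ω} {Q P : ℝ → L2 Ω →ₗ[ℝ] L2 Ω}
    (hQP : StabilizesLaplacian ι Q P) {ε : ℝ} (hε : ε ∈ Ioo (0 : ℝ) 1) {f₀ f₀' : H1 Ω}
    {f₁ f₁' : L2 Ω} {u v : Evolution Ω T} (hu : IsOriginalSolution f₀ f₁ u)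
    (hv : IsRegularizedSolution (P ε) f₀' f₁' v)
    (hpos : ∀ᵐ t ∂timeMeasure T, toL2 (u.pos t) ∈ LinearMap.range ι)
    (hvel : ∀ᵐ t ∂timeMeasure T, u.vel t ∈ LinearMap.range ι) (φ : H10 Ω) :
    ∀ᵐ t ∂timeMeasure T,
      (v.acc t φ + inner ℝ (v.vel t) (toL2 (φ : H1 Ω)))
        - (u.acc t φ + inner ℝ (u.vel t) (toL2 (φ : H1 Ω)))
      = inner ℝ (grad ((v.pos t - u.pos t) + (v.velH1 t - u.velH1 t))) (grad (φ : H1 Ω))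
        + inner ℝ (P ε ((toL2 (v.pos t) + v.vel t) - (toL2 (u.pos t) + u.vel t))
          + (Q ε (toL2 (u.pos t)) + Q ε (u.vel t))) (toL2 (φ : H1 Ω)) := by
  filter_upwards [hu.equation φ, hv.equation φ, hpos, hvel, u.pos_mem, u.velH1_mem_H10 hΩ hT,
    u.velH1_eq] with t e1 e2 p1 p2 m1 m2 e3
  -- Inserting `2Δ = P - Q` for `u` and `u_t` reverses the sign of the Laplacians in the exact
  -- equation, at the price of the source `Q u + Q u_t` in the difference.
  have s1 := hQP ε hε (u.pos t) m1 p1 φ φ.2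
  have s2 := hQP ε hε (u.velH1 t) m2 (by rwa [e3]) φ φ.2
  rw [e3] at s2
  simp only [map_add, map_sub, inner_add_left, inner_sub_left]
  linarith

set_option maxHeartbeats 1000000 in
/-- Energy bounds for the difference of a regularized and an exact solution. -/
lemma difference_bounds (hΩ : IsOpen Ω) (hT : 0 < T) {u v : Evolution Ω T} {ρ : ℝ} (hρ : 0 < ρ)
    (P : L2 Ω →L[ℝ] L2 Ω) (hP : ∀ x, ‖P x‖ ≤ ρ * ‖x‖) {G : ℝ → L2 Ω}
    (hG : MemLp G 2 (timeMeasure T))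
    (heq : ∀ φ : H10 Ω, ∀ᵐ t ∂timeMeasure T,
      (v.acc t φ + inner ℝ (v.vel t) (toL2 (φ : H1 Ω)))
        - (u.acc t φ + inner ℝ (u.vel t) (toL2 (φ : H1 Ω)))
      = inner ℝ (grad ((v.pos t - u.pos t) + (v.velH1 t - u.velH1 t))) (grad (φ : H1 Ω))
        + inner ℝ (P ((toL2 (v.pos t) + v.vel t) - (toL2 (u.pos t) + u.vel t)) + G t)
          (toL2 (φ : H1 Ω)))
    {δ g : ℝ} (hδ : ‖v.pos T - u.pos T‖ + ‖v.vel T - u.vel T‖ ≤ δ)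
    (hg : ∫ s in (0 : ℝ)..T, ‖G s‖ ^ 2 ≤ g) {t : ℝ} (ht : t ∈ Icc 0 T) {B N : ℝ}
    (hB : Real.exp (3 * ρ * (T - t)) * (δ ^ 2 + ρ⁻¹ * g) ≤ B)
    (hN : 2 * Real.exp T ^ 2 * (δ ^ 2 + T * (T + 1) * B) ≤ N) :
    ‖v.pos t - u.pos t‖ ^ 2 ≤ N ∧
      ‖v.vel t - u.vel t‖ ^ 2 + ∫ s in t..T, ‖grad (v.velH1 s - u.velH1 s)‖ ^ 2
        ≤ 2 * B + 2 * (1 + T) * N := by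
  set W : ℝ → H1 Ω := fun s => v.pos s - u.pos s with hWdef
  set Z : ℝ → H1 Ω := fun s => v.velH1 s - u.velH1 s with hZdef
  set y : ℝ → L2 Ω := fun s => (toL2 (v.pos s) + v.vel s) - (toL2 (u.pos s) + u.vel s) with hydef
  have hW : ContinuousOn W (Icc 0 T) := v.continuousOn_pos.sub u.continuousOn_pos
  have hZ : MemLp Z 2 (timeMeasure T) := v.memLp_velH1.sub u.memLp_velH1
  have hyW : ∀ s, y s = toL2 (W s) + (v.vel s - u.vel s) := fun s => by
    simp only [hydef, hWdef, map_sub]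
    abel
  have hy : ContinuousOn y (Icc 0 T) :=
    ((toL2.continuous.comp_continuousOn v.continuousOn_pos).add v.continuousOn_vel).sub
      ((toL2.continuous.comp_continuousOn u.continuousOn_pos).add u.continuousOn_vel)
  have hWZ : ∀ a b, 0 ≤ a → a ≤ b → b ≤ T → ∫ s in a..b, Z s = W b - W a := by
    intro a b ha hab hb
    simp only [hZdef, hWdef]
    rw [intervalIntegral.integral_sub
      (intervalIntegrable_of_integrable_timeMeasure (v.memLp_velH1.integrable (by norm_num))
        ha hab hb)
      (intervalIntegrable_of_integrable_timeMeasure (u.memLp_velH1.integrable (by norm_num))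
        ha hab hb), v.integral_velH1 hΩ ha hab hb, u.integral_velH1 hΩ ha hab hb]
    abel
  have hyY : ∀ᵐ s ∂timeMeasure T, toL2 (W s + Z s) = y s := by
    filter_upwards [u.velH1_eq, v.velH1_eq] with s h1 h2
    simp only [hydef, hWdef, hZdef, map_add, map_sub, h1, h2]
    abel
  have hS : ∀ᵐ s ∂timeMeasure T, W s + Z s ∈ H10 Ω := by
    filter_upwards [u.pos_mem, v.pos_mem, u.velH1_mem_H10 hΩ hT, v.velH1_mem_H10 hΩ hT]
      with s h1 h2 h3 h4
    exact (H10 Ω).add_mem ((H10 Ω).sub_mem h2 h1) ((H10 Ω).sub_mem h4 h3)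
  have hweak : ∀ φ ∈ H10 Ω, ∀ a b, 0 ≤ a → a ≤ b → b ≤ T → inner ℝ (y b - y a) (toL2 φ)
      = ∫ s in a..b, (inner ℝ (grad (W s + Z s)) (grad φ) + inner ℝ (P (y s) + G s) (toL2 φ)) := by
    intro φ hφ a b ha hab hb
    have e1 : y b - y a = ((toL2 (v.pos b) + v.vel b) - (toL2 (v.pos a) + v.vel a))
        - ((toL2 (u.pos b) + u.vel b) - (toL2 (u.pos a) + u.vel a)) := by
      simp only [hydef]
      abel
    rw [e1, inner_sub_left, v.inner_sub_eq_integral ⟨φ, hφ⟩ ha hab hb,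
      u.inner_sub_eq_integral ⟨φ, hφ⟩ ha hab hb, ← intervalIntegral.integral_sub
      (v.intervalIntegrable_acc_add_inner_vel ⟨φ, hφ⟩ ha hab hb)
      (u.intervalIntegrable_acc_add_inner_vel ⟨φ, hφ⟩ ha hab hb)]
    exact intervalIntegral.integral_congr_ae_restrict
      (ae_restrict_uIoc_of_ae_timeMeasure (heq ⟨φ, hφ⟩) ha hab hb)
  have hδ0 : 0 ≤ δ := (add_nonneg (norm_nonneg _) (norm_nonneg _)).trans hδ
  have hWT : ‖W T‖ ^ 2 ≤ δ ^ 2 :=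
    pow_le_pow_left₀ (norm_nonneg _) (by linarith [norm_nonneg (v.vel T - u.vel T)]) 2
  have hyT : ‖y T‖ ^ 2 ≤ δ ^ 2 := by
    refine pow_le_pow_left₀ (norm_nonneg _) ?_ 2
    rw [hyW]
    exact (norm_add_le _ _).trans ((add_le_add_left (norm_toL2_le _) _).trans hδ)
  have hg0 : 0 ≤ g := (intervalIntegral.integral_nonneg hT.le fun _ _ => sq_nonneg _).trans hg
  have hb0 : 0 ≤ δ ^ 2 + ρ⁻¹ * g := by positivity
  set b : ℝ → ℝ := fun s => Real.exp (3 * ρ * (T - s)) * (δ ^ 2 + ρ⁻¹ * g) with hbdef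
  have henergy : ∀ s ∈ Icc 0 T, ‖y s‖ ^ 2 + 2 * ∫ r in s..T, ‖grad (W r + Z r)‖ ^ 2 ≤ b s := by
    intro s hs
    refine (energy_estimate toL2 grad (isClosed_H10 Ω) hρ P hP hy (hW.memLp_timeMeasure.add hZ)
      hS hyY hG hweak hs).trans ?_
    exact mul_le_mul_of_nonneg_left
      (add_le_add hyT (mul_le_mul_of_nonneg_left hg (inv_nonneg.2 hρ.le))) (Real.exp_pos _).le
  -- The energy bound decreases with the starting time, so its value at `t` serves on all of `[t,
  -- T]`.
  have hanti : AntitoneOn b (Icc 0 T) := fun r _ s _ hrs =>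
    mul_le_mul_of_nonneg_right (Real.exp_le_exp.2
      (mul_le_mul_of_nonneg_left (by linarith) (by positivity))) hb0
  have hNs : ∀ s ∈ Icc t T, ‖W s‖ ^ 2 ≤ N := by
    intro s hs
    have hs' : s ∈ Icc 0 T := ⟨ht.1.trans hs.1, hs.2⟩
    refine (bounds_of_energy hW hZ hWZ hyY henergy hanti hs').trans (le_trans ?_ hN)
    have hbB : b s ≤ B := (hanti ht hs' hs.1).trans hB
    gcongr
  exact ⟨hNs t ⟨le_rfl, ht.2⟩,
    velocity_bound_of_bounds hW hZ ht ((henergy t ht).trans hB) (hyW t) hNs⟩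

/-- The square integral of the perturbation terms. -/
lemma integral_perturbation_le {W H : Type*} [NormedAddCommGroup W] [NormedSpace ℝ W]
    [NormedAddCommGroup H] [NormedSpace ℝ H] (hT : 0 ≤ T) (L : W →L[ℝ] H) {k : ℝ}
    (hL : ∀ w, ‖L w‖ ≤ k * ‖w‖) (hk : 0 ≤ k) (uW : C(Icc (0 : ℝ) T, W))
    (utW : Lp W 2 (timeMeasure T)) :
    MemLp (fun s => L (uW (projIcc 0 T hT s)) + L (utW s)) 2 (timeMeasure T) ∧
    ∫ s in (0 : ℝ)..T, ‖L (uW (projIcc 0 T hT s)) + L (utW s)‖ ^ 2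
      ≤ 2 * k ^ 2 * (T * ‖uW‖ ^ 2 + ‖utW‖ ^ 2) := by
  have hm : MemLp (fun s => L (uW (projIcc 0 T hT s)) + L (utW s)) 2 (timeMeasure T) :=
    (ContinuousOn.memLp_timeMeasure (Continuous.continuousOn
      (L.continuous.comp (uW.continuous.comp continuous_projIcc)))).add
      (L.comp_memLp' (Lp.memLp utW))
  refine ⟨hm, ?_⟩
  have i2 : Integrable (fun s => ‖utW s‖ ^ 2) (timeMeasure T) :=
    (Lp.memLp utW).integrable_norm_pow (p := 2) (by norm_num)
  have hsq : ∫ s, ‖utW s‖ ^ 2 ∂timeMeasure T = ‖utW‖ ^ 2 := by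
    rw [Lp.norm_def, (Lp.memLp utW).eLpNorm_eq_integral_rpow_norm (by norm_num) (by norm_num),
      ENNReal.toReal_ofReal (by positivity), ← Real.rpow_natCast, ← Real.rpow_mul (by positivity)]
    simp
  rw [intervalIntegral.integral_of_le hT, ← restrict_Ioo_eq_restrict_Ioc]
  have hle : ∫ s, ‖L (uW (projIcc 0 T hT s)) + L (utW s)‖ ^ 2 ∂timeMeasure T
      ≤ ∫ s, 2 * k ^ 2 * (‖uW‖ ^ 2 + ‖utW s‖ ^ 2) ∂timeMeasure T := by
    refine integral_mono (hm.integrable_norm_pow (p := 2) (by norm_num))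
      (((integrable_const _).add i2).const_mul _) fun s => ?_
    have h1 : ‖L (uW (projIcc 0 T hT s)) + L (utW s)‖ ≤ k * ‖uW‖ + k * ‖utW s‖ :=
      (norm_add_le _ _).trans (add_le_add ((hL _).trans
        (mul_le_mul_of_nonneg_left (uW.norm_coe_le_norm _) hk)) (hL _))
    have h2 := pow_le_pow_left₀ (norm_nonneg _) h1 2
    simp only
    nlinarith [sq_nonneg (k * ‖uW‖ - k * ‖utW s‖)]
  refine hle.trans (le_of_eq ?_)
  rw [integral_const_mul, integral_add (integrable_const _) i2, hsq]
  simp [hT]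

end Difference

/-! ### Choice of parameters and comparison of the bounds. -/

/-- The parameters of the error bound, for the auxiliary function `γ(ε) = ε ^ (-1/2)`. -/
lemma error_parameters {C₀ C₁ M T ε t : ℝ} (hM : 0 < M) (hC₁ : 0 < C₁)
    (hε : 0 < ε) (hε' : ε ≤ Real.exp (-4 / C₁)) (ht : t ∈ Icc 0 T)
    {ℓ : ℝ} (hℓ : ℓ = Real.log (ε ^ (-(1 / 2) : ℝ))) :
    2 / C₁ ≤ ℓ ∧ ε ^ 2 ≤ ℓ⁻¹ * ε ^ (1 - 3 * C₁ * (T - t) / 2) ∧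
    Real.exp (3 * (C₁ * ℓ) * (T - t))
        * (ε ^ 2 + (C₁ * ℓ)⁻¹ * (2 * (C₀ ^ 2 * ε) * ((2 / (3 * C₁) + 1) * M)))
      ≤ (1 + 2 * C₀ ^ 2 * (2 / (3 * C₁) + 1) * M / C₁)
        * (ℓ⁻¹ * ε ^ (1 - 3 * C₁ * (T - t) / 2)) := by
  have hℓ' : ℓ = -(1 / 2) * Real.log ε := by rw [hℓ, Real.log_rpow hε]
  have hlog : Real.log ε ≤ -4 / C₁ := (Real.log_le_iff_le_exp hε).2 hε'
  -- The smallness condition `ε ≤ exp(-4/C₁)` enters here, through `ℓ = -(log ε)/2`.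
  have h1 : 2 / C₁ ≤ ℓ := by
    have : -4 / C₁ = -2 * (2 / C₁) := by ring
    rw [hℓ']
    linarith
  have hℓ0 : 0 < ℓ := lt_of_lt_of_le (by positivity) h1
  have hε1 : ε ≤ 1 := hε'.trans (Real.exp_le_one_iff.2 (by
    rw [neg_div]
    have : 0 < 4 / C₁ := by positivity
    linarith))
  have hR : ε ^ (1 - 3 * C₁ * (T - t) / 2) = Real.exp (3 * (C₁ * ℓ) * (T - t)) * ε := by
    rw [Real.rpow_def_of_pos hε, hℓ']
    nth_rewrite 3 [← Real.exp_log hε]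
    rw [← Real.exp_add]
    ring_nf
  have hexp1 : 1 ≤ Real.exp (3 * (C₁ * ℓ) * (T - t)) :=
    Real.one_le_exp (mul_nonneg (by positivity) (by linarith [ht.2]))
  -- Equivalent to `εℓ ≤ 1`, which follows from `log x ≤ x - 1` at `x = ε⁻¹`. The squared noise is
  -- thus no larger than the scale `ℓ⁻¹ε` of the perturbation term.
  have hεℓ : ε ^ 2 ≤ ℓ⁻¹ * ε := by
    have hl : -Real.log ε ≤ ε⁻¹ - 1 := by
      have := Real.log_le_sub_one_of_pos (inv_pos.2 hε)
      rwa [Real.log_inv] at this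
    have hl2 : ε * ℓ ≤ 1 := by
      have : ℓ ≤ ε⁻¹ := by
        have : 0 < ε⁻¹ := inv_pos.2 hε
        rw [hℓ']
        linarith
      calc ε * ℓ ≤ ε * ε⁻¹ := mul_le_mul_of_nonneg_left this hε.le
        _ = 1 := mul_inv_cancel₀ hε.ne'
    have : ε ≤ ℓ⁻¹ := by
      rw [← one_div, le_div_iff₀ hℓ0]
      exact hl2
    nlinarith
  rw [hR]
  set e := Real.exp (3 * (C₁ * ℓ) * (T - t)) with he
  have hℓε : 0 ≤ ℓ⁻¹ * ε := by positivity
  refine ⟨h1, ?_, ?_⟩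
  · nlinarith
  · have : e * (ℓ⁻¹ * ε + (C₁ * ℓ)⁻¹ * (2 * (C₀ ^ 2 * ε) * ((2 / (3 * C₁) + 1) * M)))
        = (1 + 2 * C₀ ^ 2 * (2 / (3 * C₁) + 1) * M / C₁) * (ℓ⁻¹ * (e * ε)) := by
      field_simp
    rw [← this]
    gcongr

/-- Comparison of the uniform bound with the right hand sides of the error estimates. -/
lemma error_bounds {c κ ℓ ε R : ℝ} (hc : 0 < c) (hκ : 0 ≤ κ) (hℓ : 2 / c ≤ ℓ) (hε : 0 < ε)
    (hR : 0 ≤ R) :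
    κ * (ℓ⁻¹ * R) ≤ κ * (1 + c) ^ 2 * (ε + ℓ⁻¹ * R) ∧
    κ * (ℓ⁻¹ * R) ≤ κ * (1 + c) ^ 2 * (ℓ * ε + R) ∧
    κ * (ℓ⁻¹ * R) ≤ κ * (1 + c) ^ 2 * (ℓ ^ 2 * ε + ℓ * R) := by
  have hℓ0 : 0 < ℓ := lt_of_lt_of_le (by positivity) hℓ
  -- Only `ℓ⁻¹ ≤ c` matters: it trades `ℓ⁻¹` for `c`, or for `c²ℓ`, and `(1 + c)²` dominates `1`,
  -- `c` and `c²` simultaneously.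
  have hcl : 1 ≤ c * ℓ := by
    rw [div_le_iff₀ hc] at hℓ
    linarith
  have h1 : (1 : ℝ) ≤ (1 + c) ^ 2 := by nlinarith
  have hinv : ℓ⁻¹ ≤ c := by
    rw [← one_div, div_le_iff₀ hℓ0]
    exact hcl
  have hinv2 : ℓ⁻¹ ≤ c ^ 2 * ℓ := by nlinarith
  have e1 : ℓ⁻¹ * R ≤ (1 + c) ^ 2 * (ε + ℓ⁻¹ * R) := by
    have : 0 ≤ ℓ⁻¹ * R := by positivity
    nlinarith
  have e2 : ℓ⁻¹ * R ≤ (1 + c) ^ 2 * (ℓ * ε + R) := by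
    have h2 : ℓ⁻¹ * R ≤ (1 + c) ^ 2 * R := mul_le_mul_of_nonneg_right (by nlinarith) hR
    have : 0 ≤ (1 + c) ^ 2 * (ℓ * ε) := by positivity
    linarith
  have e3 : ℓ⁻¹ * R ≤ (1 + c) ^ 2 * (ℓ ^ 2 * ε + ℓ * R) := by
    have h2 : ℓ⁻¹ * R ≤ (1 + c) ^ 2 * ℓ * R := mul_le_mul_of_nonneg_right (by nlinarith) hR
    have : 0 ≤ (1 + c) ^ 2 * (ℓ ^ 2 * ε) := by positivity
    linarith
  refine ⟨?_, ?_, ?_⟩ <;> rw [mul_assoc κ]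
  · exact mul_le_mul_of_nonneg_left e1 hκ
  · exact mul_le_mul_of_nonneg_left e2 hκ
  · exact mul_le_mul_of_nonneg_left e3 hκ

lemma div_rpow_neg_half_sq (c : ℝ) {ε : ℝ} (hε : 0 < ε) :
    (c / ε ^ (-(1 / 2) : ℝ)) ^ 2 = c ^ 2 * ε := by
  rw [div_pow, ← Real.rpow_natCast (ε ^ (-(1 / 2) : ℝ)), ← Real.rpow_mul hε.le, div_eq_mul_inv,
    ← Real.rpow_neg hε.le]
  norm_num

set_option maxHeartbeats 1000000 in
/-- The error bounds in terms of the terminal data and of the perturbation, before the parameters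
are compared. -/
lemma regularization_error {d : ℕ} {Ω : Set (E d)} (hΩ : IsOpen Ω) {T M k ρ ε τ : ℝ} (hT : 0 < T)
    (hTτ : T ≤ τ) {W : Type*} [NormedAddCommGroup W] [NormedSpace ℝ W] {ι : W →ₗ[ℝ] L2 Ω}
    {Q P : ℝ → L2 Ω →ₗ[ℝ] L2 Ω} (hε : ε ∈ Ioo (0 : ℝ) 1) (hk : 0 ≤ k) (hρ : 0 < ρ)
    (hQ : ∀ w, ‖(Q ε ∘ₗ ι) w‖ ≤ k * ‖w‖) (hP : ∀ h, ‖P ε h‖ ≤ ρ * ‖h‖)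
    (hQP : StabilizesLaplacian ι Q P) {f₀ f₀' : H1 Ω} {f₁ f₁' : L2 Ω} {u v : Evolution Ω T}
    (hu : IsOriginalSolution f₀ f₁ u) (hv : IsRegularizedSolution (P ε) f₀' f₁' v)
    (uW : C(Set.Icc (0 : ℝ) T, W)) (utW : MeasureTheory.Lp W 2 (timeMeasure T))
    (huW : ∀ t : Set.Icc (0 : ℝ) T, ι (uW t) = toL2 (u.pos t))
    (hutW : ∀ᵐ t ∂timeMeasure T, ι (utW t) = u.vel t) (hM : ‖uW‖ ^ 2 + ‖utW‖ ^ 2 ≤ M)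
    {δ : ℝ} (hf : ‖f₀' - f₀‖ + ‖f₁' - f₁‖ ≤ δ) {t : ℝ} (ht : t ∈ Icc 0 T) {B N : ℝ}
    (hB : Real.exp (3 * ρ * (T - t)) * (δ ^ 2 + ρ⁻¹ * (2 * k ^ 2 * ((τ + 1) * M))) ≤ B)
    (hN : 2 * Real.exp T ^ 2 * (δ ^ 2 + T * (T + 1) * B) ≤ N) :
    ‖v.pos t - u.pos t‖ ^ 2 ≤ N ∧
      ‖v.vel t - u.vel t‖ ^ 2 + ∫ s in t..T, ‖grad (v.velH1 s - u.velH1 s)‖ ^ 2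
        ≤ 2 * B + 2 * (1 + T) * N := by
  obtain ⟨hGm, hGle⟩ := integral_perturbation_le hT.le ((Q ε ∘ₗ ι).mkContinuous k hQ) hQ hk uW utW
  have hposW : ∀ s ∈ Icc 0 T, toL2 (u.pos s) = ι (uW (projIcc 0 T hT.le s)) := fun s hs => by
    rw [huW, projIcc_of_mem hT.le hs]
  have heq := difference_equation hΩ hT hQP hε hu hv
    (by
      filter_upwards [ae_restrict_mem measurableSet_Ioo] with s hs
      exact ⟨_, (hposW s (Ioo_subset_Icc_self hs)).symm⟩)
    (by
      filter_upwards [hutW] with s hs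
      exact ⟨_, hs⟩)
  have hg : 2 * k ^ 2 * (T * ‖uW‖ ^ 2 + ‖utW‖ ^ 2) ≤ 2 * k ^ 2 * ((τ + 1) * M) := by
    refine mul_le_mul_of_nonneg_left ?_ (by positivity)
    calc T * ‖uW‖ ^ 2 + ‖utW‖ ^ 2 ≤ (τ + 1) * ‖uW‖ ^ 2 + (τ + 1) * ‖utW‖ ^ 2 := by
          gcongr
          · linarith
          · exact le_mul_of_one_le_left (sq_nonneg _) (by linarith)
      _ = (τ + 1) * (‖uW‖ ^ 2 + ‖utW‖ ^ 2) := by ring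
      _ ≤ (τ + 1) * M := mul_le_mul_of_nonneg_left hM (by linarith)
  have hterm : ‖v.pos T - u.pos T‖ + ‖v.vel T - u.vel T‖ ≤ δ := by
    rw [hv.terminal_pos, hv.terminal_vel, hu.terminal_pos, hu.terminal_vel]
    exact hf
  refine difference_bounds hΩ hT hρ ((P ε).mkContinuous ρ hP) hP hGm (fun φ => ?_) hterm
    (hGle.trans hg) ht hB hN
  filter_upwards [heq φ, hutW, ae_restrict_mem measurableSet_Ioo] with s h1 h2 h3
  rw [h1, hposW s (Ioo_subset_Icc_self h3), ← h2]
  rfl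

end

/-! ### The error estimates with explicit constants. -/

theorem corollary1 (M C₀ C₁ : ℝ) (hM : 0 < M) (hC₀ : 0 < C₀) (hC₁ : 0 < C₁) :
    ∃ C : ℝ, 0 < C ∧
      ∀ (d : ℕ) (Ω : Set (E d)), IsOpen Ω → Bornology.IsBounded Ω →
      ∀ T : ℝ, 0 < T → 3 * C₁ * T < 2 →
      -- the function space `W ⊆ L²(Ω)`
      ∀ (W : Type*) [NormedAddCommGroup W] [NormedSpace ℝ W] (ι : W →ₗ[ℝ] L2 Ω),
      Function.Injective ι →
      -- perturbing and stabilized operators, for the choice `γ(ε) = ε ^ (-1/2)`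
      ∀ Q P : ℝ → L2 Ω →ₗ[ℝ] L2 Ω,
      IsPerturbingFamily ι (fun ε => ε ^ (-(1 / 2) : ℝ)) C₀ Q →
      IsStabilizedFamily (fun ε => ε ^ (-(1 / 2) : ℝ)) C₁ P →
      StabilizesLaplacian ι Q P →
      -- the exact solution, with `u ∈ C([0,T]; W)` and `u_t ∈ L²(0,T; W)`
      ∀ (f₀ : H1 Ω) (f₁ : L2 Ω) (u : Evolution Ω T), IsOriginalSolution f₀ f₁ u →
      ∀ (uW : C(Set.Icc (0 : ℝ) T, W)) (utW : MeasureTheory.Lp W 2 (timeMeasure T)),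
      (∀ t : Set.Icc (0 : ℝ) T, ι (uW t) = toL2 (u.pos t)) →
      (∀ᵐ t ∂timeMeasure T, ι (utW t) = u.vel t) →
      ‖uW‖ ^ 2 + ‖utW‖ ^ 2 ≤ M →
      -- the regularized solution for terminal data with noise level `ε`
      ∀ ε : ℝ, 0 < ε → ε ≤ Real.exp (-4 / C₁) →
      ∀ (f₀ε : H1 Ω) (f₁ε : L2 Ω), ‖f₀ε - f₀‖ + ‖f₁ε - f₁‖ ≤ ε →
      ∀ uε : Evolution Ω T, IsRegularizedSolution (P ε) f₀ε f₁ε uε →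
      ∀ t ∈ Set.Icc (0 : ℝ) T,
        ‖toL2 (uε.pos t) - toL2 (u.pos t)‖ ^ 2
            ≤ C * (ε + (Real.log (ε ^ (-(1 / 2) : ℝ)))⁻¹ * ε ^ (1 - 3 * C₁ * (T - t) / 2)) ∧
        ‖grad (uε.pos t) - grad (u.pos t)‖ ^ 2
            ≤ C * (Real.log (ε ^ (-(1 / 2) : ℝ)) * ε + ε ^ (1 - 3 * C₁ * (T - t) / 2)) ∧
        ‖uε.vel t - u.vel t‖ ^ 2
              + ∫ s in t..T, ‖grad (uε.velH1 s) - grad (u.velH1 s)‖ ^ 2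
            ≤ C * (Real.log (ε ^ (-(1 / 2) : ℝ)) ^ 2 * ε
                + Real.log (ε ^ (-(1 / 2) : ℝ)) * ε ^ (1 - 3 * C₁ * (T - t) / 2)) := by
  have hτ0 : 0 < 2 / (3 * C₁) := by positivity
  -- The assumption `3 C₁ T < 2` gives `T ≤ τ`, so replacing `T` by `τ` makes all constants
  -- independent of `T`. In units of `ℓ⁻¹R`, `K` bounds the energy of `w + w_t`, `N` the squared
  -- `H¹` norm of `w`, and `κ` the velocity terms.
  obtain ⟨τ, hτ⟩ : ∃ τ, τ = 2 / (3 * C₁) := ⟨_, rfl⟩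
  rw [← hτ] at hτ0
  obtain ⟨K, hK⟩ : ∃ K, K = 1 + 2 * C₀ ^ 2 * (τ + 1) * M / C₁ := ⟨_, rfl⟩
  have hK0 : 0 < K := by
    rw [hK]
    positivity
  obtain ⟨N, hN⟩ : ∃ N, N = 2 * Real.exp τ ^ 2 * (1 + τ * (τ + 1) * K) := ⟨_, rfl⟩
  have hN0 : 0 < N := by
    rw [hN]
    positivity
  obtain ⟨κ, hκ⟩ : ∃ κ, κ = 2 * K + 2 * (1 + τ) * N := ⟨_, rfl⟩
  have hκ0 : 0 < κ := by
    rw [hκ]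
    positivity
  refine ⟨κ * (1 + C₁) ^ 2, by positivity, ?_⟩
  intro d Ω hΩ _ T hT hCT W _ _ ι _ Q P hQ hP hQP f₀ f₁ u hu uW utW huW hutW hM' ε hε hε'
    f₀ε f₁ε hf uε huε t ht
  have hTτ : T ≤ τ := by
    rw [hτ, le_div_iff₀ (by positivity)]
    linarith
  have hε1 : ε ∈ Ioo (0 : ℝ) 1 := ⟨hε, hε'.trans_lt (Real.exp_lt_one_iff.2
    (div_neg_of_neg_of_pos (by norm_num) hC₁))⟩
  obtain ⟨hℓ, hεR, hBle⟩ := error_parameters (C₀ := C₀) hM hC₁ hε hε' ht rfl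
  have hR0 : 0 ≤ ε ^ (1 - 3 * C₁ * (T - t) / 2) := Real.rpow_nonneg hε.le _
  have hP' := hP ε hε1
  simp only at hP'
  -- From here on `ℓ` and `R` enter only through the inequalities already obtained.
  generalize Real.log (ε ^ (-(1 / 2) : ℝ)) = ℓ at *
  generalize ε ^ (1 - 3 * C₁ * (T - t) / 2) = R at *
  have hℓ0 : 0 < ℓ := lt_of_lt_of_le (by positivity) hℓ
  have hS0 : 0 ≤ ℓ⁻¹ * R := by positivity
  rw [← hτ, ← hK, ← div_rpow_neg_half_sq C₀ hε] at hBle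
  have hQk : ∀ w, ‖(Q ε ∘ₗ ι) w‖ ≤ C₀ / ε ^ (-(1 / 2) : ℝ) * ‖w‖ := fun w =>
    (hQ ε hε1 w).trans (le_of_eq (mul_div_right_comm _ _ _))
  have hNle : 2 * Real.exp T ^ 2 * (ε ^ 2 + T * (T + 1) * (K * (ℓ⁻¹ * R))) ≤ N * (ℓ⁻¹ * R) := by
    calc 2 * Real.exp T ^ 2 * (ε ^ 2 + T * (T + 1) * (K * (ℓ⁻¹ * R)))
        ≤ 2 * Real.exp τ ^ 2 * (ℓ⁻¹ * R + τ * (τ + 1) * (K * (ℓ⁻¹ * R))) := by gcongr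
      _ = N * (ℓ⁻¹ * R) := by
        rw [hN]
        ring
  obtain ⟨hW, hZ⟩ := regularization_error hΩ hT hTτ hε1
    (div_nonneg hC₀.le (Real.rpow_nonneg hε.le _)) (mul_pos hC₁ hℓ0) hQk hP' hQP hu huε uW utW huW
    hutW hM' hf ht hBle hNle
  have hNκ : N * (ℓ⁻¹ * R) ≤ κ * (ℓ⁻¹ * R) := by
    refine mul_le_mul_of_nonneg_right ?_ hS0
    rw [hκ]
    linarith [mul_pos hτ0 hN0]
  have hZκ : 2 * (K * (ℓ⁻¹ * R)) + 2 * (1 + T) * (N * (ℓ⁻¹ * R)) ≤ κ * (ℓ⁻¹ * R) := by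
    calc 2 * (K * (ℓ⁻¹ * R)) + 2 * (1 + T) * (N * (ℓ⁻¹ * R))
        ≤ 2 * (K * (ℓ⁻¹ * R)) + 2 * (1 + τ) * (N * (ℓ⁻¹ * R)) := by gcongr
      _ = κ * (ℓ⁻¹ * R) := by
        rw [hκ]
        ring
  obtain ⟨b1, b2, b3⟩ := error_bounds (κ := κ) hC₁ hκ0.le hℓ hε hR0
  refine ⟨?_, ?_, ?_⟩
  · rw [← map_sub]
    exact (pow_le_pow_left₀ (norm_nonneg _) (norm_toL2_le _) 2).trans
      ((hW.trans hNκ).trans b1)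
  · rw [← map_sub]
    exact (pow_le_pow_left₀ (norm_nonneg _) (norm_grad_le _) 2).trans
      ((hW.trans hNκ).trans b2)
  · simp only [← map_sub]
    exact (hZ.trans hZκ).trans b3
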